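/- Let $Y$ be an almost surely positive random variable with distribution function $F$, and let $\gamma\in\mathbb{R}$. Assume $F\in\mathcal{D}(G_\gamma)$, the maximum domain of attraction of the extreme value distribution $G_\gamma$: for some $a_n>0$, $b_n\in\mathbb{R}$, the normalized maximum of $n$ i.i.d. copies of $Y$, minus $b_n$ and divided by $a_n$, converges in distribution to $G_\gamma$, where $G_\gamma(x)=\exp(-(1+\gamma x)^{-1/\gamma})$ for $1+\gamma x>0$ if $\gamma\neq0$ (and, where $1+\gamma x\le 0$, $G_\gamma(x)=0$ if $\gamma>0$ and $1$ if $\gamma<0$), and $G_0(x)=\exp(-e^{-x})$. Let $U(t)=\inf\{y: F(y)\ge 1-1/t\}$, $t>1$, and let $a$ be an (eventually positive) scaling function of $U$, i.e. $\lim_{t\to\infty}\frac{U(tx)-U(t)}{a(t)}=\frac{x^\gamma-1}{\gamma}$ for all $x>0$. Throughout, $\frac{x^\gamma-1}{\gamma}$ is read as $\ln x$ when $\gamma=0$, and limits are as $n\to\infty$. For random variables $X_n$ and numbers $w_n$, write $X_n=O_{\mathbb P}(w_n)$ if $X_n=w_nZ_n$ almost surely, for all large $n$, with a uniformly tight sequence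 of random variables $Z_n$. For a sample $\boldsymbol x=(x_1,\dots,x_n)$ with order statistics $\boldsymbol x_{1,n}\le\dots\le \boldsymbol x_{n,n}$, integers $1\le k<n$ and $p>0$, set $$M^{(\ell)}_n(\boldsymbol x)=\frac1k\sum_{j=0}^{k-1}(\ln \boldsymbol x_{n-j,n}-\ln \boldsymbol x_{n-k,n})^\ell,\quad \hat\gamma_+=M^{(1)}_n,\quad \hat\gamma_-=1-\frac12\Big(1-\frac{(M^{(1)}_n)^2}{M^{(2)}_n}\Big)^{-1},$$ $$\hat\gamma_M=\hat\gamma_++\hat\gamma_-,\quad \hat\sigma_M(\boldsymbol x)=\boldsymbol x_{n-k,n}M^{(1)}_n(\boldsymbol x)(1-\hat\gamma_-(\boldsymbol x)),\quad \hat x_p(\boldsymbol x)=\boldsymbol x_{n-k,n}+\hat\sigma_M(\boldsymbol x)\frac{(k/(np))^{\hat\gamma_M(\boldsymbol x)}-1}{\hat\gamma_M(\boldsymbol x)}.$$ For each $n$ let $\boldsymbol Y=(Y_1,\dots,Y_n)$ be i.i.d. copies of $Y$ and let $\hat{\boldsymbol Y}=(\hat Y_1,\dots,\hat Y_n)$ be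 random variables on the same probability space (an approximated sample). Suppose (A1) $k=k_n\to\infty$ and $k/n\to0$, and that $$\max_{0\le j\le k}\Big|\frac{\hat{\boldsymbol Y}_{n-j,n}}{\boldsymbol Y_{n-j,n}}-1\Big|=O_{\mathbb P}(h_n)$$ for some real sequence $h_n$ such that $z_n=h_nU(n/k)/a(n/k)\to0$. Then $$|\hat\gamma_M(\hat{\boldsymbol Y})-\hat\gamma_M(\boldsymbol Y)|=O_{\mathbb P}(z_n),\qquad \Big|\frac{\hat{\boldsymbol Y}_{n-k,n}-\boldsymbol Y_{n-k,n}}{a(n/k)}\Big|=O_{\mathbb P}(z_n),\qquad \Big|\frac{\hat\sigma_M(\hat{\boldsymbol Y})-\hat\sigma_M(\boldsymbol Y)}{a(n/k)}\Big|=O_{\mathbb P}(z_n).$$ Suppose furthermore that (A2) $p=p_n>0$, $np=o(k)$ and $\ln(np)=o(\sqrt k)$, and (A3) $\sqrt k(\hat\gamma_M(\boldsymbol Y)-\gamma)=O_{\mathbb P}(1)$ and $\sqrt k\,z_n=O(1)$. Let $d_n=k/(np)$ and $q_\gamma(t)=\int_1^t s^{\gamma-1}\ln s\,\mathrm{d}s$.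 Then $$\Big|\frac{\hat x_p(\hat{\boldsymbol Y})-\hat x_p(\boldsymbol Y)}{a(n/k)\,q_\gamma(d_n)}\Big|=O_{\mathbb P}(z_n).$$ -/

import Mathlib

open MeasureTheory ProbabilityTheory Filter Topology Asymptotics

noncomputable section

namespace EVT

/-- The `i`-th smallest value (`1 ≤ i ≤ n`) of the sample `x` of size `n`, i.e. the order statistic
`x_{i,n}`, so that `x_{1,n} ≤ ⋯ ≤ x_{n,n}`.  Out of range it is `0`. -/
def orderStat {n : ℕ} (x : Fin n → ℝ) (i : ℕ) : ℝ :=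
  if h : 1 ≤ i ∧ i ≤ n then x (Tuple.sort x ⟨i - 1, by omega⟩) else 0

/-- The generalized extreme value distribution function `G_γ`, on the whole real line. -/
def gevCDF (γ x : ℝ) : ℝ :=
  if γ = 0 then Real.exp (-Real.exp (-x))
  else if 0 < 1 + γ * x then Real.exp (-(1 + γ * x) ^ (-1 / γ))
  else if 0 < γ then 0 else 1

/-- The law `μ` is in the maximum domain of attraction of the distribution function `G`: for some
`a_n > 0` and `b_n`, the normalized maximum `(Y_{n,n} - b_n) / a_n` of an i.i.d. sample of size `n`
from `μ` converges in distribution to `G`. -/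
def InMaxDomainOfAttraction (μ : Measure ℝ) (G : ℝ → ℝ) : Prop :=
  ∃ a b : ℕ → ℝ, (∀ n, 0 < a n) ∧ ∀ x : ℝ, ContinuousAt G x →
    Tendsto (fun n : ℕ =>
      (Measure.pi (fun _ : Fin n => μ)).real {y | (orderStat y n - b n) / a n ≤ x})
      atTop (𝓝 (G x))

/-- `U(t) = F^←(1 - 1/t)`, with `F` the distribution function of `μ` and `F^←` its left-continuous
inverse. -/
def tailQuantile (μ : Measure ℝ) (t : ℝ) : ℝ :=
  sInf {y : ℝ | 1 - 1 / t ≤ cdf μ y}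

/-- `(x ^ γ - 1) / γ`, read as `log x` for `γ = 0`. -/
def powQuot (γ x : ℝ) : ℝ :=
  if γ = 0 then Real.log x else (x ^ γ - 1) / γ

/-- `U` is extended regularly varying with index `γ` and scaling function `a`. -/
def IsERV (U : ℝ → ℝ) (γ : ℝ) (a : ℝ → ℝ) : Prop :=
  (∀ᶠ t in atTop, 0 < a t) ∧
    ∀ x : ℝ, 0 < x → Tendsto (fun t => (U (t * x) - U t) / a t) atTop (𝓝 (powQuot γ x))

/-- `M_n^{(ℓ)}`, based on the top `k + 1` order statistics of the sample `x`. -/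
def logMoment (k ℓ : ℕ) {n : ℕ} (x : Fin n → ℝ) : ℝ :=
  (1 / (k : ℝ)) * ∑ j ∈ Finset.range k,
    (Real.log (orderStat x (n - j)) - Real.log (orderStat x (n - k))) ^ ℓ

/-- The Hill estimator. -/
def gammaPlus (k : ℕ) {n : ℕ} (x : Fin n → ℝ) : ℝ :=
  logMoment k 1 x

def gammaMinus (k : ℕ) {n : ℕ} (x : Fin n → ℝ) : ℝ :=
  1 - (1 / 2) * (1 - logMoment k 1 x ^ 2 / logMoment k 2 x)⁻¹

/-- The moment estimator of the extreme value index. -/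
def gammaMoment (k : ℕ) {n : ℕ} (x : Fin n → ℝ) : ℝ :=
  gammaPlus k x + gammaMinus k x

/-- The moment-based estimator of the scale `a(n/k)`. -/
def sigmaMoment (k : ℕ) {n : ℕ} (x : Fin n → ℝ) : ℝ :=
  orderStat x (n - k) * logMoment k 1 x * (1 - gammaMinus k x)

/-- The moment-based estimator of the extreme quantile `U(1/p)`. -/
def extremeQuantile (k : ℕ) (p : ℝ) {n : ℕ} (x : Fin n → ℝ) : ℝ :=
  orderStat x (n - k) +
    sigmaMoment k x * powQuot (gammaMoment k x) ((k : ℝ) / ((n : ℝ) * p))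

/-- `q_γ(t) = ∫_1^t s^{γ-1} log s ds`. -/
def qFun (γ t : ℝ) : ℝ :=
  ∫ s in (1 : ℝ)..t, s ^ (γ - 1) * Real.log s

/-- `max_{0 ≤ j ≤ k} |x'_{n-j,n} / x_{n-j,n} - 1|`. -/
def maxRelError (k : ℕ) {n : ℕ} (x' x : Fin n → ℝ) : ℝ :=
  (Finset.range (k + 1)).sup' Finset.nonempty_range_add_one
    (fun j => |orderStat x' (n - j) / orderStat x (n - j) - 1|)

/-- `X_n = O_ℙ(W_n)`: there is a uniformly tight sequence of random variables `Z_n` with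
`X_n = W_n Z_n` almost surely, for all large `n`. -/
def IsBigOP {Ω : Type*} [MeasurableSpace Ω] (P : Measure Ω) (X W : ℕ → Ω → ℝ) : Prop :=
  ∃ Z : ℕ → Ω → ℝ, (∀ n, AEMeasurable (Z n) P) ∧
    IsTightMeasureSet (Set.range fun n => P.map (Z n)) ∧
    ∀ᶠ n in atTop, ∀ᵐ ω ∂P, X n ω = W n ω * Z n ω

end EVT

end

open EVT

/-!
The three estimators depend on the sample only through the threshold `X = x_{n-k,n}` and the first
two moments `M₁, M₂` of the log-spacings `log x_{n-j,n} - log x_{n-k,n}`.  A relative error of size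
`δ` in the order statistics moves each log-spacing by `O(δ)`, hence `M₁` by `O(δ)` and `M₂` by
`O(δ (M₁ + δ))`.  Write `A = a(n/k) / U(n/k)`, so that `δ = O(h_n)` means `δ = O(z_n A)`.  Since
`1 - γ̂₋ = M₂ / (2 (M₂ - M₁²))`, the estimators are stable at the rate `z_n` as soon as `M₁ = O(A)`
and the empirical variance `M₂ - M₁²` is at least of order `A²`
(`exists_perturbation_bounds`); exact limits of the moments are not needed.

These orders of magnitude are proved in `exists_asympCertain_logMoment_bounds`.

* By Chebyshev's inequality for the number of observations above the levels `U(c n/k)`, with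
  probability tending to one the top `k/16` observations exceed `U(8n/k)`, while those of rank `k/2`
  to `k` lie below `U(4n/k)`.  As `log U(8t) - log U(4t)` is of order `a(t)/U(t)`, this separates
  two positive fractions of the log-spacings and bounds their variance from below.
* With probability tending to one the threshold exceeds `U(n/(2k))`, so that `M₁` is at most `1/k`
  times the total excess of `log Y_i` over `log U(n/(2k))`.  Its mean is `O(k A)`: level
  `U(2^m t)` is exceeded with probability at most `2^(-m)/t`, and the increments of `log U` between
  these levels grow at most like `(3/2)^m a(t)/U(t)`, a Potter type bound
  (`IsERV.scale_div_dyadic_le`).  Markov's inequality applies.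

For the extreme quantile, `(d^g - 1)/g` is `∫₁ᵈ s^(g-1) ds`.  Both index estimates `g` are within
`O(1/√k)` of `γ` and `log d = o(√k)`, so `s^(g-1)` is bounded by a multiple of `s^(γ-1)` on `[1, d]`
and the mean value inequality in `g` produces exactly the factor `q_γ(d)` (`abs_powQuot_sub_le`).
-/

namespace EVT

open scoped ENNReal

/-! ### The function `(x^γ - 1)/γ` -/

lemma powQuot_mul (γ : ℝ) {x y : ℝ} (hx : 0 < x) (hy : 0 < y) :
    powQuot γ (x * y) = x ^ γ * powQuot γ y + powQuot γ x := by
  unfold powQuot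
  split_ifs with h
  · subst h
    rw [Real.log_mul hx.ne' hy.ne', Real.rpow_zero]; ring
  · rw [Real.mul_rpow hx.le hy.le]
    field_simp
    ring

lemma powQuot_one (γ : ℝ) : powQuot γ 1 = 0 := by simp [powQuot]

lemma powQuot_two_pos (γ : ℝ) : 0 < powQuot γ 2 := by
  unfold powQuot
  split_ifs with h
  · exact Real.log_pos one_lt_two
  · rcases lt_or_gt_of_ne h with h | h
    · exact div_pos_of_neg_of_neg
        (sub_neg.2 (Real.rpow_lt_one_of_one_lt_of_neg one_lt_two h)) h
    · exact div_pos (sub_pos.2 (Real.one_lt_rpow one_lt_two h)) h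

/-! ### The tail quantile function -/

section TailQuantile

variable (μ : Measure ℝ)

lemma tailQuantile_set_nonempty {t : ℝ} (ht : 1 < t) :
    {y : ℝ | 1 - 1 / t ≤ cdf μ y}.Nonempty := by
  have h1 : 1 - 1 / t < 1 := by
    have : 0 < 1 / t := by positivity
    linarith
  obtain ⟨y, hy⟩ := ((tendsto_cdf_atTop μ).eventually (lt_mem_nhds h1)).exists
  exact ⟨y, hy.le⟩

lemma tailQuantile_set_bddBelow {t : ℝ} (ht : 1 < t) :
    BddBelow {y : ℝ | 1 - 1 / t ≤ cdf μ y} := by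
  have h1 : 0 < 1 - 1 / t := by
    have : 1 / t < 1 := by rw [div_lt_one] <;> linarith
    linarith
  obtain ⟨y, hy⟩ := ((tendsto_cdf_atBot μ).eventually (gt_mem_nhds h1)).exists
  refine ⟨y, fun x hx => ?_⟩
  by_contra! hlt
  have := monotone_cdf μ hlt.le
  simp only [Set.mem_ofPred_eq] at hx
  linarith

lemma le_cdf_tailQuantile {t : ℝ} (ht : 1 < t) : 1 - 1 / t ≤ cdf μ (tailQuantile μ t) := by
  have hc : Tendsto (cdf μ) (𝓝[>] (tailQuantile μ t)) (𝓝 (cdf μ (tailQuantile μ t))) :=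
    ((cdf μ).right_continuous _).tendsto.mono_left
      (nhdsWithin_mono _ Set.Ioi_subset_Ici_self)
  refine ge_of_tendsto hc ?_
  filter_upwards [self_mem_nhdsWithin] with y hy
  obtain ⟨x, hx, hxy⟩ := exists_lt_of_csInf_lt (tailQuantile_set_nonempty μ ht) hy
  exact le_trans hx (monotone_cdf μ hxy.le)

lemma cdf_lt_of_lt_tailQuantile {t y : ℝ} (ht : 1 < t) (hy : y < tailQuantile μ t) :
    cdf μ y < 1 - 1 / t := by
  by_contra! h
  exact absurd (csInf_le (tailQuantile_set_bddBelow μ ht) h) (not_le.2 hy)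

lemma tailQuantile_le_tailQuantile {s t : ℝ} (hs : 1 < s) (hst : s ≤ t) :
    tailQuantile μ s ≤ tailQuantile μ t := by
  refine csInf_le (tailQuantile_set_bddBelow μ hs) ?_
  refine le_trans ?_ (le_cdf_tailQuantile μ (hs.trans_le hst))
  have : 1 / t ≤ 1 / s := one_div_le_one_div_of_le (by linarith) hst
  linarith

variable [IsProbabilityMeasure μ]

lemma measureReal_Ioi_tailQuantile_le {t : ℝ} (ht : 1 < t) :
    μ.real (Set.Ioi (tailQuantile μ t)) ≤ 1 / t := by
  have h := le_cdf_tailQuantile μ ht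
  rw [cdf_eq_real] at h
  rw [← Set.compl_Iic, probReal_compl_eq_one_sub measurableSet_Iic]
  linarith

lemma le_measureReal_Ici_tailQuantile {t : ℝ} (ht : 1 < t) :
    1 / t ≤ μ.real (Set.Ici (tailQuantile μ t)) := by
  obtain ⟨u, hu, hlt, hlim⟩ := exists_seq_strictMono_tendsto (tailQuantile μ t)
  have hU : Set.Iio (tailQuantile μ t) = ⋃ n, Set.Iic (u n) := by
    ext x
    simp only [Set.mem_Iio, Set.mem_iUnion, Set.mem_Iic]
    constructor
    · intro hx
      obtain ⟨n, hn⟩ := (hlim.eventually (lt_mem_nhds hx)).exists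
      exact ⟨n, hn.le⟩
    · rintro ⟨n, hn⟩
      exact hn.trans_lt (hlt n)
  have hmono : Monotone fun n => Set.Iic (u n) := fun i j hij =>
    Set.Iic_subset_Iic.2 (hu.monotone hij)
  have h1 : Tendsto (fun n => μ.real (Set.Iic (u n))) atTop
      (𝓝 (μ.real (Set.Iio (tailQuantile μ t)))) := by
    rw [hU]
    exact (ENNReal.tendsto_toReal (measure_ne_top μ _)).comp
      (tendsto_measure_iUnion_atTop hmono)
  have h2 : μ.real (Set.Iio (tailQuantile μ t)) ≤ 1 - 1 / t := by
    refine le_of_tendsto h1 (Eventually.of_forall fun n => ?_)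
    have := cdf_lt_of_lt_tailQuantile μ ht (hlt n)
    rw [cdf_eq_real] at this
    exact this.le
  rw [← Set.compl_Iio, probReal_compl_eq_one_sub measurableSet_Iio]
  linarith

lemma tailQuantile_pos (h0 : μ (Set.Iic 0) = 0) {t : ℝ} (ht : 1 < t) :
    0 < tailQuantile μ t := by
  by_contra! hle
  have h1 := le_cdf_tailQuantile μ ht
  have h2 := monotone_cdf μ hle
  rw [cdf_eq_real μ 0, measureReal_def, h0, ENNReal.toReal_zero] at h2
  have : 1 / t < 1 := by rw [div_lt_one] <;> linarith
  linarith

end TailQuantile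

/-! ### Extended regular variation of `U` and the growth of `a / U` -/

section ERV

variable {U a : ℝ → ℝ} {γ : ℝ}

/-- Regular variation of `a`, obtained by writing the increment of `U` from `2t` to `4t` both in units
of `a(2t)` and in units of `a(t)`. -/
lemma IsERV.tendsto_scale_ratio (h : IsERV U γ a) :
    Tendsto (fun t => a (t * 2) / a t) atTop (𝓝 (2 ^ γ)) := by
  have hp := powQuot_two_pos γ
  have h2 : Tendsto (fun t : ℝ => t * 2) atTop atTop :=
    tendsto_id.atTop_mul_const two_pos
  have hg := h.2 2 two_pos
  have hf := h.2 (2 * 2) (by norm_num)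
  have hq := (hf.sub hg).div (hg.comp h2) hp.ne'
  have hval : (powQuot γ (2 * 2) - powQuot γ 2) / powQuot γ 2 = 2 ^ γ := by
    rw [powQuot_mul γ two_pos two_pos]
    field_simp
    ring
  rw [hval] at hq
  refine hq.congr' ?_
  filter_upwards [h.1, h2.eventually h.1, (hg.comp h2).eventually (lt_mem_nhds hp)]
    with t h1 h3 h4
  simp only [Function.comp_apply] at h4
  have h5 : U (t * 2 * 2) - U (t * 2) ≠ 0 := by
    intro h0; rw [h0, zero_div] at h4; exact lt_irrefl _ h4
  simp only [Pi.div_apply, Function.comp_apply]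
  rw [show t * (2 * 2) = t * 2 * 2 by ring, ← sub_div, sub_sub_sub_cancel_right,
    div_div_div_cancel_left' _ _ h5]

/-- The scaling function is at most of the order of `U`, since `U` is nonnegative and
`U(t) - U(t/2)` is already of order `a(t)`. -/
lemma IsERV.scale_le (h : IsERV U γ a) (hpos : ∀ t, 1 < t → 0 < U t) :
    ∃ C > 0, ∀ᶠ t in atTop, a t ≤ C * U t := by
  have hc : 0 < -powQuot γ (1 / 2) := by
    have h1 := powQuot_mul γ (x := 1 / 2) (y := 2) (by norm_num) two_pos
    rw [show (1 / 2 : ℝ) * 2 = 1 by norm_num, powQuot_one] at h1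
    have : 0 < (1 / 2 : ℝ) ^ γ * powQuot γ 2 :=
      mul_pos (Real.rpow_pos_of_pos (by norm_num) _) (powQuot_two_pos γ)
    linarith
  set c := -powQuot γ (1 / 2) with hcdef
  refine ⟨2 / c, by positivity, ?_⟩
  have hlim := h.2 (1 / 2) (by norm_num)
  have : powQuot γ (1 / 2) < -(c / 2) := by linarith
  filter_upwards [hlim.eventually (gt_mem_nhds this), h.1, eventually_gt_atTop 2] with t h1 h2 h3
  have h4 := hpos (t * (1 / 2)) (by linarith)
  rw [div_lt_iff₀ h2] at h1
  rw [div_mul_eq_mul_div, le_div_iff₀ hc]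
  nlinarith

lemma IsERV.increment_le (h : IsERV U γ a) {x : ℝ} (hx : 0 < x) :
    ∃ C > 0, ∀ᶠ t in atTop, U (t * x) - U t ≤ C * a t := by
  refine ⟨|powQuot γ x| + 1, by positivity, ?_⟩
  have : powQuot γ x < |powQuot γ x| + 1 := (le_abs_self _).trans_lt (lt_add_one _)
  filter_upwards [(h.2 x hx).eventually (gt_mem_nhds this), h.1] with t h1 h2
  rw [div_lt_iff₀ h2] at h1
  exact h1.le

lemma IsERV.le_const_mul (h : IsERV U γ a) (hpos : ∀ t, 1 < t → 0 < U t) {x : ℝ} (hx : 0 < x) :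
    ∃ C > 0, ∀ᶠ t in atTop, U (t * x) ≤ C * U t := by
  obtain ⟨C₁, h₁, H₁⟩ := h.scale_le hpos
  obtain ⟨C₂, h₂, H₂⟩ := h.increment_le hx
  refine ⟨1 + C₂ * C₁, by positivity, ?_⟩
  filter_upwards [H₁, H₂] with t h3 h4
  have := mul_le_mul_of_nonneg_left h3 h₂.le
  linarith

/-- For `γ > 0` the scaling function is also at least of the order of `U`.  The ratio
`V = U / a` satisfies `V(2t) ≤ (V(t) + C) / ρ` with some `ρ > 1`, so a bound on one dyadic block
`[t₀, 2t₀)` propagates; on that block `a` is bounded below by an increment of `U`. -/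
lemma IsERV.le_scale (h : IsERV U γ a) (hpos : ∀ t, 1 < t → 0 < U t)
    (hmono : ∀ s t, 1 < s → s ≤ t → U s ≤ U t) (hγ : 0 < γ) :
    ∃ C > 0, ∀ᶠ t in atTop, U t ≤ C * a t := by
  obtain ⟨C₁, hC₁, H₁⟩ := h.increment_le (x := 2) two_pos
  obtain ⟨C₂, hC₂, H₂⟩ := h.increment_le (x := 4) (by norm_num)
  have h2γ : (1 : ℝ) < 2 ^ γ := Real.one_lt_rpow one_lt_two hγ
  obtain ⟨ρ, hρ1, hρ2⟩ := exists_between h2γ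
  have hinc : ∀ᶠ t in atTop, U t < U (t * 2) := by
    filter_upwards [(h.2 2 two_pos).eventually (lt_mem_nhds (powQuot_two_pos γ)), h.1] with t h1 h2
    have := (div_pos_iff_of_pos_right h2).1 h1
    linarith
  obtain ⟨t₀, ht₀⟩ := eventually_atTop.1 (H₁.and (H₂.and ((h.1).and (hinc.and
    ((h.tendsto_scale_ratio.eventually (lt_mem_nhds hρ2)).and (eventually_gt_atTop 1))))))
  obtain ⟨-, -, -, -, -, h1⟩ := ht₀ t₀ le_rfl
  obtain ⟨-, -, -, hd, -, -⟩ := ht₀ (t₀ * 2) (by linarith)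
  set d := U (t₀ * 2 * 2) - U (t₀ * 2) with hd_def
  have hd0 : 0 < d := sub_pos.2 hd
  set K := max (C₂ * U (t₀ * 2) / d) (C₁ / (ρ - 1)) with hK
  have hU0 := hpos (t₀ * 2) (by linarith)
  have hK1 : C₂ * U (t₀ * 2) ≤ K * d := by
    rw [← div_le_iff₀ hd0]; exact le_max_left _ _
  have hK2 : C₁ ≤ K * (ρ - 1) := by
    rw [← div_le_iff₀ (by linarith)]; exact le_max_right _ _
  have hK0 : 0 < K := lt_of_lt_of_le (div_pos hC₁ (by linarith)) (le_max_right _ _)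
  have key : ∀ m : ℕ, ∀ t, t₀ ≤ t → t < t₀ * 2 ^ (m + 1) → U t ≤ K * a t := by
    intro m
    induction m with
    | zero =>
      intro t h3 h4
      obtain ⟨-, h5, h6, -, -, -⟩ := ht₀ t h3
      rw [zero_add, pow_one] at h4
      have h7 : U t ≤ U (t₀ * 2) := hmono _ _ (by linarith) (by linarith)
      have h8 : U (t₀ * 2 * 2) ≤ U (t * 4) := hmono _ _ (by linarith) (by linarith)
      have h9 : d ≤ C₂ * a t := by linarith
      have h10 : C₂ * U (t₀ * 2) ≤ C₂ * (K * a t) := by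
        nlinarith [mul_le_mul_of_nonneg_left h9 hK0.le]
      exact h7.trans (le_of_mul_le_mul_left h10 hC₂)
    | succ m ih =>
      intro t h3 h4
      rcases lt_or_ge t (t₀ * 2) with h5 | h5
      · refine ih t h3 (h5.trans_le ?_)
        rw [pow_succ]
        have : (1 : ℝ) ≤ 2 ^ m := one_le_pow₀ one_le_two
        nlinarith
      · obtain ⟨g1, -, g2, -, g3, -⟩ := ht₀ (t / 2) (by linarith)
        have g4 := ih (t / 2) (by linarith) (by rw [pow_succ] at h4; linarith)
        rw [show t / 2 * 2 = t by ring] at g1 g3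
        rw [lt_div_iff₀ g2] at g3
        have g5 := mul_le_mul_of_nonneg_right hK2 g2.le
        have g6 := mul_le_mul_of_nonneg_left g3.le hK0.le
        linarith
  refine ⟨K, hK0, ?_⟩
  filter_upwards [eventually_ge_atTop t₀] with t ht
  obtain ⟨m, hm⟩ := pow_unbounded_of_one_lt (t / t₀) one_lt_two
  refine key m t ht ?_
  rw [div_lt_iff₀ (by linarith)] at hm
  rw [pow_succ]
  nlinarith [pow_pos (two_pos : (0 : ℝ) < 2) m]

/-- A dyadic Potter bound for `a / U`: for `γ ≤ 0` the ratio of consecutive dyadic values is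
eventually below `3 / 2`, and for `γ > 0` the function is bounded away from `0` and `∞`.  The
growth rate `3 / 2` only has to be smaller than `2`. -/
lemma IsERV.scale_div_dyadic_le (h : IsERV U γ a) (hpos : ∀ t, 1 < t → 0 < U t)
    (hmono : ∀ s t, 1 < s → s ≤ t → U s ≤ U t) :
    ∃ C > 0, ∀ᶠ t in atTop, ∀ m : ℕ,
      a (t * 2 ^ m) / U (t * 2 ^ m) ≤ C * (3 / 2) ^ m * (a t / U t) := by
  rcases le_or_gt γ 0 with hγ | hγ
  · refine ⟨1, one_pos, ?_⟩
    have h2 : (2 : ℝ) ^ γ < 3 / 2 :=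
      (Real.rpow_le_one_of_one_le_of_nonpos one_le_two hγ).trans_lt (by norm_num)
    obtain ⟨t₀, ht₀⟩ := eventually_atTop.1 (h.1.and
      ((h.tendsto_scale_ratio.eventually (gt_mem_nhds h2)).and (eventually_gt_atTop 1)))
    filter_upwards [eventually_ge_atTop t₀] with t ht m
    induction m with
    | zero => simp
    | succ m ih =>
      have ht1 := (ht₀ t ht).2.2
      have hs : t ≤ t * 2 ^ m := le_mul_of_one_le_right (by linarith) (one_le_pow₀ one_le_two)
      set s := t * 2 ^ m with hs_def
      obtain ⟨g1, g2, g3⟩ := ht₀ s (ht.trans hs)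
      rw [show t * 2 ^ (m + 1) = s * 2 by rw [hs_def]; ring]
      have g4 : U s ≤ U (s * 2) := hmono _ _ g3 (by linarith)
      have g5 := hpos s g3
      rw [div_lt_iff₀ g1] at g2
      have g6 : a (s * 2) / U (s * 2) ≤ (3 / 2 * a s) / U s :=
        div_le_div₀ (by positivity) g2.le g5 g4
      calc _ ≤ _ := g6
        _ = 3 / 2 * (a s / U s) := by ring
        _ ≤ 3 / 2 * (1 * (3 / 2) ^ m * (a t / U t)) := by gcongr
        _ = _ := by ring
  · obtain ⟨C₁, hC₁, H₁⟩ := h.scale_le hpos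
    obtain ⟨C₂, hC₂, H₂⟩ := h.le_scale hpos hmono hγ
    refine ⟨C₁ * C₂, by positivity, ?_⟩
    obtain ⟨t₀, ht₀⟩ := eventually_atTop.1 (H₁.and (H₂.and (eventually_gt_atTop 1)))
    filter_upwards [eventually_ge_atTop t₀] with t ht m
    obtain ⟨-, g1, g2⟩ := ht₀ t ht
    have hs : t ≤ t * 2 ^ m := le_mul_of_one_le_right (by linarith) (one_le_pow₀ one_le_two)
    obtain ⟨g3, -, g4⟩ := ht₀ _ (ht.trans hs)
    have g5 := hpos t g2
    have g6 : a (t * 2 ^ m) / U (t * 2 ^ m) ≤ C₁ := by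
      rw [div_le_iff₀ (hpos _ g4)]; exact g3
    have g7 : 1 ≤ C₂ * (a t / U t) := by
      rw [← mul_div_assoc, le_div_iff₀ g5]; linarith
    have g8 : (1 : ℝ) ≤ (3 / 2) ^ m := one_le_pow₀ (by norm_num)
    calc _ ≤ _ := g6
      _ ≤ C₁ * ((3 / 2) ^ m * (C₂ * (a t / U t))) :=
        le_mul_of_one_le_right hC₁.le (one_le_mul_of_one_le_of_one_le g8 g7)
      _ = _ := by ring

/-- The dyadic increments of `log U` above the level `t / 2`, in units of `a(t) / U(t)`. -/
lemma IsERV.log_dyadic_increment_le (h : IsERV U γ a) (hpos : ∀ t, 1 < t → 0 < U t)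
    (hmono : ∀ s t, 1 < s → s ≤ t → U s ≤ U t) :
    ∃ C > 0, ∀ᶠ t in atTop, ∀ m : ℕ,
      Real.log (U (t / 2 * 2 ^ (m + 1))) - Real.log (U (t / 2 * 2 ^ m)) ≤
        C * (3 / 2) ^ m * (a t / U t) := by
  obtain ⟨C₁, hC₁, H₁⟩ := h.scale_div_dyadic_le hpos hmono
  obtain ⟨C₂, hC₂, H₂⟩ := h.increment_le (x := 2) two_pos
  obtain ⟨C₃, hC₃, H₃⟩ := h.le_const_mul hpos (x := 2) two_pos
  have h2γ : (0 : ℝ) < 2 ^ γ := Real.rpow_pos_of_pos two_pos _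
  have H₄ := h.tendsto_scale_ratio.eventually (lt_mem_nhds (half_lt_self h2γ))
  obtain ⟨t₀, ht₀⟩ := eventually_atTop.1 (H₁.and (H₂.and (H₃.and (H₄.and (h.1.and
    (eventually_gt_atTop 1))))))
  refine ⟨C₂ * (C₁ * (C₃ * (2 / 2 ^ γ))), by positivity, ?_⟩
  filter_upwards [eventually_ge_atTop (t₀ * 2)] with t ht m
  have ht1 : t₀ ≤ t / 2 := by linarith
  obtain ⟨g1, -, g2, g3, g4, g5⟩ := ht₀ (t / 2) ht1
  rw [div_mul_cancel₀ t (two_ne_zero)] at g2 g3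
  have hs : t / 2 ≤ t / 2 * 2 ^ m :=
    le_mul_of_one_le_right (by linarith) (one_le_pow₀ one_le_two)
  have g6 := g1 m
  rw [pow_succ, ← mul_assoc]
  set s := t / 2 * 2 ^ m with hs_def
  obtain ⟨-, f1, -, -, f2, f3⟩ := ht₀ s (ht1.trans hs)
  have f4 := hpos s f3
  have f5 := hpos (s * 2) (by linarith)
  have f6 : Real.log (U (s * 2)) - Real.log (U s) ≤ C₂ * (a s / U s) := by
    rw [← Real.log_div f5.ne' f4.ne']
    refine (Real.log_le_sub_one_of_pos (div_pos f5 f4)).trans ?_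
    rw [div_sub_one f4.ne', ← mul_div_assoc]
    gcongr
  have g7 := hpos _ g5
  have hat : 0 < a t := (ht₀ t (by linarith)).2.2.2.2.1
  have hUt := hpos t (by linarith)
  have f7 : a (t / 2) / U (t / 2) ≤ C₃ * (2 / 2 ^ γ) * (a t / U t) := by
    have e1 : a (t / 2) ≤ 2 / 2 ^ γ * a t := by
      rw [lt_div_iff₀ g4] at g3
      rw [div_mul_eq_mul_div, le_div_iff₀ h2γ]
      linarith
    have e2 : 1 / U (t / 2) ≤ C₃ / U t := by
      rw [div_le_div_iff₀ g7 hUt]; linarith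
    calc _ = a (t / 2) * (1 / U (t / 2)) := by ring
      _ ≤ (2 / 2 ^ γ * a t) * (C₃ / U t) := by gcongr
      _ = _ := by ring
  calc _ ≤ _ := f6
    _ ≤ C₂ * (C₁ * (3 / 2) ^ m * (C₃ * (2 / 2 ^ γ) * (a t / U t))) := by
      gcongr; exact g6.trans (by gcongr)
    _ = _ := by ring

lemma IsERV.le_log_increment (h : IsERV U γ a) (hpos : ∀ t, 1 < t → 0 < U t) :
    ∃ c > 0, ∀ᶠ t in atTop,
      c * (a t / U t) ≤ Real.log (U (t * 8)) - Real.log (U (t * 4)) := by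
  have hp := powQuot_two_pos γ
  have hd : powQuot γ 8 - powQuot γ 4 = 4 ^ γ * powQuot γ 2 := by
    rw [show (8 : ℝ) = 4 * 2 by norm_num, powQuot_mul γ (by norm_num) two_pos]; ring
  have hd0 : 0 < 4 ^ γ * powQuot γ 2 :=
    mul_pos (Real.rpow_pos_of_pos (by norm_num) _) hp
  set d := 4 ^ γ * powQuot γ 2
  obtain ⟨C, hC, H⟩ := h.le_const_mul hpos (x := 8) (by norm_num)
  have hlim := (h.2 8 (by norm_num)).sub (h.2 4 (by norm_num))
  rw [hd] at hlim
  refine ⟨d / 2 / C, by positivity, ?_⟩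
  filter_upwards [H, h.1, hlim.eventually (lt_mem_nhds (half_lt_self hd0)),
    eventually_gt_atTop 1] with t h1 h2 h3 h4
  have g1 := hpos t h4
  have g2 := hpos (t * 8) (by linarith)
  have g3 := hpos (t * 4) (by linarith)
  rw [← sub_div, sub_sub_sub_cancel_right, lt_div_iff₀ h2] at h3
  have g4 : d / 2 / C * (a t / U t) ≤ (U (t * 8) - U (t * 4)) / U (t * 8) := by
    calc _ = d / 2 * a t / (C * U t) := by field_simp
      _ ≤ _ := by
        refine div_le_div₀ ?_ h3.le g2 h1
        exact (mul_pos (half_pos hd0) h2).le.trans h3.le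
  refine g4.trans ?_
  have := Real.log_le_sub_one_of_pos (div_pos g3 g2)
  rw [Real.log_div g3.ne' g2.ne'] at this
  rw [sub_div, div_self g2.ne']
  linarith

end ERV

/-! ### Order statistics and measurability of the estimators -/

section OrderStatistics

variable {n : ℕ} {x : Fin n → ℝ} {i j : ℕ} {c : ℝ}

lemma orderStat_eq (x : Fin n → ℝ) (h1 : 1 ≤ i) (hn : i ≤ n) :
    orderStat x i = x (Tuple.sort x ⟨i - 1, by omega⟩) := by
  rw [orderStat, dif_pos ⟨h1, hn⟩]

lemma exists_orderStat_eq (x : Fin n → ℝ) (h1 : 1 ≤ i) (hn : i ≤ n) :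
    ∃ l, orderStat x i = x l := ⟨_, orderStat_eq x h1 hn⟩

lemma orderStat_le_orderStat (x : Fin n → ℝ) (h1 : 1 ≤ i) (hij : i ≤ j) (hn : j ≤ n) :
    orderStat x i ≤ orderStat x j := by
  rw [orderStat_eq x h1 (hij.trans hn), orderStat_eq x (h1.trans hij) hn]
  exact Tuple.monotone_sort x (Fin.mk_le_mk.2 (by omega))

lemma card_filter_comp_perm (p : ℝ → Prop) [DecidablePred p] (x : Fin n → ℝ)
    (σ : Equiv.Perm (Fin n)) :
    (Finset.univ.filter fun l => p ((x ∘ σ) l)).card = (Finset.univ.filter fun l => p (x l)).card :=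
  Finset.card_bijective σ σ.bijective (by simp)

lemma orderStat_le_iff (h1 : 1 ≤ i) (hn : i ≤ n) :
    orderStat x i ≤ c ↔ i ≤ (Finset.univ.filter fun l => x l ≤ c).card := by
  rw [orderStat_eq x h1 hn, ← card_filter_comp_perm (· ≤ c) x (Tuple.sort x)]
  have := Tuple.lt_card_le_iff_apply_le_of_monotone (a := c) (j := ⟨i - 1, by omega⟩)
    (Tuple.monotone_sort x)
  rw [Function.comp_apply] at this
  rw [← this, Fin.val_mk]
  omega

lemma orderStat_lt_iff (h1 : 1 ≤ i) (hn : i ≤ n) :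
    orderStat x i < c ↔ i ≤ (Finset.univ.filter fun l => x l < c).card := by
  rw [orderStat_eq x h1 hn, ← card_filter_comp_perm (· < c) x (Tuple.sort x)]
  have := Tuple.lt_card_lt_iff_apply_lt_of_monotone (a := c) (j := ⟨i - 1, by omega⟩)
    (Tuple.monotone_sort x)
  rw [Function.comp_apply] at this
  rw [← this, Fin.val_mk]
  omega

lemma orderStat_sub_le (hj : j < n) (h : (Finset.univ.filter fun l => c < x l).card ≤ j) :
    orderStat x (n - j) ≤ c := by
  rw [orderStat_le_iff (by omega) (by omega)]
  have := Finset.card_filter_add_card_filter_not (s := (Finset.univ : Finset (Fin n)))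
    (fun l => x l ≤ c)
  simp only [not_le, Finset.card_univ, Fintype.card_fin] at this
  omega

lemma le_orderStat_sub (hj : j < n) (h : j < (Finset.univ.filter fun l => c ≤ x l).card) :
    c ≤ orderStat x (n - j) := by
  by_contra! hlt
  rw [orderStat_lt_iff (by omega) (by omega)] at hlt
  have := Finset.card_filter_add_card_filter_not (s := (Finset.univ : Finset (Fin n)))
    (fun l => x l < c)
  simp only [not_lt, Finset.card_univ, Fintype.card_fin] at this
  omega

lemma sum_orderStat_le (x : Fin n → ℝ) {k : ℕ} (hk : k ≤ n) {f : ℝ → ℝ} (hf : ∀ y, 0 ≤ f y) :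
    ∑ j ∈ Finset.range k, f (orderStat x (n - j)) ≤ ∑ l, f (x l) := by
  have h : ∑ l, f (x l) = ∑ j ∈ Finset.range n, f (orderStat x (n - j)) := by
    rw [← Fin.sum_univ_eq_sum_range (fun j => f (orderStat x (n - j))),
      ← Equiv.sum_comp (Fin.revPerm.trans (Tuple.sort x))]
    refine Finset.sum_congr rfl fun l _ => ?_
    rw [orderStat_eq x (by omega) (by omega)]
    have hl : (⟨n - l - 1, by omega⟩ : Fin n) = Fin.revPerm l := by
      ext
      simp only [Fin.revPerm_apply, Fin.val_rev]
      omega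
    rw [hl, Equiv.trans_apply]
  rw [h]
  exact Finset.sum_le_sum_of_subset_of_nonneg (Finset.range_subset_range.2 hk) fun _ _ _ => hf _

lemma measurable_orderStat (n i : ℕ) : Measurable fun x : Fin n → ℝ => orderStat x i := by
  by_cases h : 1 ≤ i ∧ i ≤ n
  · refine measurable_of_Iic fun c => ?_
    have : (fun x : Fin n → ℝ => orderStat x i) ⁻¹' Set.Iic c =
        {x | i ≤ ∑ l : Fin n, if x l ≤ c then 1 else 0} := by
      ext x
      simp only [Set.mem_preimage, Set.mem_Iic, Set.mem_ofPred_eq]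
      rw [orderStat_le_iff h.1 h.2, Finset.card_filter]
    rw [this]
    refine measurableSet_le measurable_const (Finset.measurable_sum _ fun l _ => ?_)
    exact Measurable.ite (measurableSet_le (measurable_pi_apply l) measurable_const)
      measurable_const measurable_const
  · simp only [orderStat, dif_neg h, measurable_const]

lemma measurable_logMoment (k ℓ n : ℕ) :
    Measurable fun x : Fin n → ℝ => logMoment k ℓ x := by
  unfold logMoment
  refine Measurable.const_mul (Finset.measurable_sum _ fun j _ => ?_) _
  exact ((measurable_orderStat n _).log.sub (measurable_orderStat n _).log).pow_const _

lemma measurable_gammaMinus (k n : ℕ) : Measurable fun x : Fin n → ℝ => gammaMinus k x := by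
  unfold gammaMinus
  exact ((((measurable_logMoment k 1 n).pow_const 2).div
    (measurable_logMoment k 2 n)).const_sub 1).inv.const_mul _ |>.const_sub 1

lemma measurable_gammaMoment (k n : ℕ) : Measurable fun x : Fin n → ℝ => gammaMoment k x :=
  (measurable_logMoment k 1 n).add (measurable_gammaMinus k n)

lemma measurable_sigmaMoment (k n : ℕ) : Measurable fun x : Fin n → ℝ => sigmaMoment k x :=
  ((measurable_orderStat n _).mul (measurable_logMoment k 1 n)).mul
    ((measurable_gammaMinus k n).const_sub 1)

lemma measurable_powQuot_left (d : ℝ) : Measurable fun g : ℝ => powQuot g d := by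
  unfold powQuot
  exact Measurable.ite (measurableSet_singleton (0 : ℝ)) measurable_const (by fun_prop)

lemma measurable_extremeQuantile (k : ℕ) (p : ℝ) (n : ℕ) :
    Measurable fun x : Fin n → ℝ => extremeQuantile k p x :=
  (measurable_orderStat n _).add ((measurable_sigmaMoment k n).mul
    ((measurable_powQuot_left _).comp (measurable_gammaMoment k n)))

end OrderStatistics

/-! ### Boundedness in probability and counting -/

section InProbability

variable {Ω : Type*} [MeasurableSpace Ω] {P : Measure Ω} {ι κ : Type*}

/-- A family of events `G b n`, indexed by a size parameter `b` and the sample size `n`, is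
asymptotically certain if for every `ε > 0` some `b` makes `G b n` fail with probability at most
`ε` for all large `n`.  With `G B n = {|X_n| ≤ B}` this is stochastic boundedness of `X_n`. -/
def AsympCertain (P : Measure Ω) (G : ι → ℕ → Ω → Prop) : Prop :=
  ∀ ε : ℝ≥0∞, 0 < ε → ∃ b, ∀ᶠ n in atTop, P {ω | ¬ G b n ω} ≤ ε

lemma AsympCertain.and {G : ι → ℕ → Ω → Prop} {H : κ → ℕ → Ω → Prop}
    (hG : AsympCertain P G) (hH : AsympCertain P H) :
    AsympCertain P fun (b : ι × κ) n ω => G b.1 n ω ∧ H b.2 n ω := by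
  intro ε hε
  obtain ⟨b, hb⟩ := hG (ε / 2) (ENNReal.half_pos hε.ne')
  obtain ⟨c, hc⟩ := hH (ε / 2) (ENNReal.half_pos hε.ne')
  refine ⟨(b, c), ?_⟩
  filter_upwards [hb, hc] with n h1 h2
  calc P {ω | ¬ (G b n ω ∧ H c n ω)} ≤ P ({ω | ¬ G b n ω} ∪ {ω | ¬ H c n ω}) :=
        measure_mono fun ω hω => by
          simp only [Set.mem_ofPred_eq, Set.mem_union] at hω ⊢; tauto
    _ ≤ ε / 2 + ε / 2 := (measure_union_le _ _).trans (add_le_add h1 h2)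
    _ = ε := ENNReal.add_halves ε

lemma AsympCertain.mono {G : ι → ℕ → Ω → Prop} {H : κ → ℕ → Ω → Prop}
    (hG : AsympCertain P G)
    (h : ∀ b, ∃ c, ∀ᶠ n in atTop, ∀ᵐ ω ∂P, G b n ω → H c n ω) : AsympCertain P H := by
  intro ε hε
  obtain ⟨b, hb⟩ := hG ε hε
  obtain ⟨c, hc⟩ := h b
  refine ⟨c, ?_⟩
  filter_upwards [hb, hc] with n h1 h2
  refine (measure_mono_ae ?_).trans h1
  filter_upwards [h2] with ω hω h3 h4
  exact h3 (hω h4)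

lemma asympCertain_of_tendsto {G : ℕ → Ω → Prop} {u : ℕ → ℝ≥0∞}
    (hu : Tendsto u atTop (𝓝 0)) (h : ∀ᶠ n in atTop, P {ω | ¬ G n ω} ≤ u n) :
    AsympCertain P fun (_ : Unit) n ω => G n ω := by
  intro ε hε
  refine ⟨(), ?_⟩
  filter_upwards [h, hu.eventually (gt_mem_nhds hε)] with n h1 h2
  exact h1.trans h2.le

lemma IsBigOP.asympCertain {X : ℕ → Ω → ℝ} {w : ℕ → ℝ} (h : IsBigOP P X fun n _ => w n) :
    AsympCertain P fun (B : ℝ) n ω => |X n ω| ≤ B * |w n| := by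
  obtain ⟨Z, hZ, hT, hX⟩ := h
  intro ε hε
  rw [isTightMeasureSet_iff_tendsto_measure_norm_gt] at hT
  obtain ⟨B, hB⟩ := (hT.eventually (gt_mem_nhds hε)).exists
  refine ⟨B, ?_⟩
  filter_upwards [hX] with n hn
  have h1 : P.map (Z n) {y | B < ‖y‖} ≤ ε := by
    refine le_trans ?_ hB.le
    exact le_iSup₂_of_le (P.map (Z n)) ⟨n, rfl⟩ le_rfl
  rw [Measure.map_apply_of_aemeasurable (hZ n)
    (measurableSet_lt measurable_const measurable_norm)] at h1
  refine (measure_mono_ae ?_).trans h1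
  filter_upwards [hn] with ω hω
  intro (h2 : ¬ |X n ω| ≤ B * |w n|)
  show B < ‖Z n ω‖
  rw [hω, abs_mul, mul_comm, not_le] at h2
  exact lt_of_mul_lt_mul_right h2 (abs_nonneg _)

variable [IsProbabilityMeasure P]

/-- Where `w n = 0` the relation `X_n = O_ℙ(w_n)` forces `X_n = 0` almost surely, which a bound
in probability does not give; this is the hypothesis `h0`. -/
lemma AsympCertain.isBigOP {X : ℕ → Ω → ℝ} {w : ℕ → ℝ}
    (hX : ∀ n, AEMeasurable (X n) P)
    (h0 : ∀ᶠ n in atTop, w n = 0 → ∀ᵐ ω ∂P, X n ω = 0)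
    (h : AsympCertain P fun (B : ℝ) n ω => |X n ω| ≤ B * |w n|) :
    IsBigOP P X fun n _ => w n := by
  have hZ : ∀ n, AEMeasurable (fun ω => X n ω / w n) P := fun n => (hX n).div_const _
  refine ⟨fun n ω => X n ω / w n, hZ, ?_, ?_⟩
  · have := fun n => Measure.isProbabilityMeasure_map (hZ n)
    apply isTightMeasureSet_range_of_tendsto_limsup_measure_norm_gt
    rw [ENNReal.tendsto_nhds_zero]
    intro ε hε
    obtain ⟨B, hB⟩ := h ε hε
    filter_upwards [eventually_ge_atTop (max B 0)] with r hr
    refine limsup_le_of_le (by isBoundedDefault) ?_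
    filter_upwards [hB] with n hn
    rw [Measure.map_apply_of_aemeasurable (hZ n)
      (measurableSet_lt measurable_const measurable_norm)]
    refine (measure_mono fun ω hω => ?_).trans hn
    have h1 : r < |X n ω / w n| := hω
    have hr0 : 0 ≤ r := (le_max_right _ _).trans hr
    have hw : w n ≠ 0 := by
      rintro h2
      rw [h2, div_zero, abs_zero] at h1
      linarith
    rw [abs_div, lt_div_iff₀ (abs_pos.2 hw)] at h1
    simp only [Set.mem_ofPred_eq, not_le]
    refine lt_of_le_of_lt ?_ h1
    gcongr
    exact (le_max_left _ _).trans hr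
  · filter_upwards [h0] with n hn
    by_cases hw : w n = 0
    · filter_upwards [hn hw] with ω hω
      rw [hω, hw, zero_mul]
    · exact Eventually.of_forall fun ω => by field_simp

/-- Chebyshev's inequality for the number of sample points in `S`: its variance is at most its
mean `n q`. -/
lemma measure_count_deviation_le {n : ℕ} {X : Fin n → Ω → ℝ} {ν : Measure ℝ}
    (hX : ∀ l, AEMeasurable (X l) P) (hind : iIndepFun X P) (hν : ∀ l, P.map (X l) = ν)
    {S : Set ℝ} [DecidablePred (· ∈ S)] (hS : MeasurableSet S) {c : ℝ} (hc : 0 < c) :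
    P {ω | c ≤ |((Finset.univ.filter fun l => X l ω ∈ S).card : ℝ) - n * ν.real S|} ≤
      ENNReal.ofReal (n * ν.real S / c ^ 2) := by
  set g : ℝ → ℝ := S.indicator 1 with hg
  have hgm : Measurable g := measurable_one.indicator hS
  have hg01 : ∀ y, ‖g y‖ ≤ 1 := fun y => by
    by_cases hy : y ∈ S <;> simp [hg, hy]
  have hm : ∀ l, AEMeasurable (g ∘ X l) P := fun l => hgm.comp_aemeasurable (hX l)
  have hL : ∀ l, MemLp (g ∘ X l) 2 P := fun l =>
    MemLp.of_bound (hm l).aestronglyMeasurable 1 (Eventually.of_forall fun ω => hg01 _)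
  have hmean : ∀ l, P[g ∘ X l] = ν.real S := fun l => by
    simp only [Function.comp_apply]
    rw [← integral_map (hX l) hgm.aestronglyMeasurable, hν l, hg, integral_indicator_one hS]
  have hvar : ∀ l, variance (g ∘ X l) P ≤ ν.real S := fun l => by
    refine (variance_le_expectation_sq (hm l).aestronglyMeasurable).trans (le_of_eq ?_)
    rw [← hmean l]
    refine integral_congr_ae (Eventually.of_forall fun ω => ?_)
    by_cases hy : X l ω ∈ S <;> simp [hg, hy]
  have hsum : variance (∑ l, g ∘ X l) P ≤ n * ν.real S := by
    rw [IndepFun.variance_sum (fun l _ => hL l) fun l _ l' _ hne =>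
      (hind.comp (fun _ => g) fun _ => hgm).indepFun hne]
    calc _ ≤ ∑ _l : Fin n, ν.real S := Finset.sum_le_sum fun l _ => hvar l
      _ = _ := by simp
  have hEsum : P[∑ l, g ∘ X l] = n * ν.real S := by
    simp only [Finset.sum_apply]
    rw [integral_finsetSum _ fun l _ => (hL l).integrable one_le_two]
    simp only [hmean]
    simp
  have key := meas_ge_le_variance_div_sq (memLp_finsetSum' _ fun l _ => hL l : MemLp
    (∑ l, g ∘ X l) 2 P) hc
  rw [hEsum] at key
  refine le_trans (le_of_eq ?_) (key.trans (ENNReal.ofReal_le_ofReal (by gcongr)))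
  congr 1
  ext ω
  have : (∑ l, g ∘ X l) ω = ((Finset.univ.filter fun l => X l ω ∈ S).card : ℝ) := by
    rw [Finset.sum_apply, Finset.card_filter]
    push_cast
    refine Finset.sum_congr rfl fun l _ => ?_
    simp [hg, Set.indicator_apply]
  rw [Set.mem_ofPred_eq, Set.mem_ofPred_eq, this]

end InProbability

/-! ### A lower bound for the empirical variance -/

section Spread

/-- If the first sixteenth of `s 0, …, s (k-1)` lies above `u` and the last half below `v ≤ u`, then
the empirical variance is at least `(u - v)² / 64`: the mean is at distance at least `(u - v) / 2`
from one of the two groups. -/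
lemma sq_div_le_empirical_variance {k : ℕ} (hk : 2 ≤ k) {s : ℕ → ℝ} {u v : ℝ} (huv : v ≤ u)
    (hu : ∀ j, 16 * j < k → u ≤ s j) (hv : ∀ j, j < k → k ≤ 2 * j → s j ≤ v) :
    (u - v) ^ 2 / 64 ≤ (1 / (k : ℝ)) * ∑ j ∈ Finset.range k, s j ^ 2
      - ((1 / (k : ℝ)) * ∑ j ∈ Finset.range k, s j) ^ 2 := by
  have hk0 : (0 : ℝ) < k := by positivity
  set m := (1 / (k : ℝ)) * ∑ j ∈ Finset.range k, s j with hm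
  have hsum : ∑ j ∈ Finset.range k, s j = k * m := by rw [hm]; field_simp
  have hvar : (1 / (k : ℝ)) * ∑ j ∈ Finset.range k, s j ^ 2 - m ^ 2 =
      (1 / (k : ℝ)) * ∑ j ∈ Finset.range k, (s j - m) ^ 2 := by
    simp only [sub_sq, Finset.sum_add_distrib, Finset.sum_sub_distrib, Finset.sum_const,
      Finset.card_range, nsmul_eq_mul, ← Finset.sum_mul, ← Finset.mul_sum, hsum]
    field_simp
    ring
  rw [hvar, one_div, inv_mul_eq_div, le_div_iff₀ hk0]
  have group : ∀ G ⊆ Finset.range k, k ≤ 16 * G.card →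
      (∀ j ∈ G, ((u - v) / 2) ^ 2 ≤ (s j - m) ^ 2) →
      (u - v) ^ 2 / 64 * k ≤ ∑ j ∈ Finset.range k, (s j - m) ^ 2 := by
    intro G hG hcard hj
    have h1 : (k : ℝ) ≤ 16 * G.card := by exact_mod_cast hcard
    calc (u - v) ^ 2 / 64 * k ≤ (u - v) ^ 2 / 64 * (16 * G.card) := by gcongr
      _ = G.card • ((u - v) / 2) ^ 2 := by rw [nsmul_eq_mul]; ring
      _ ≤ ∑ j ∈ G, (s j - m) ^ 2 := Finset.card_nsmul_le_sum _ _ _ hj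
      _ ≤ _ := Finset.sum_le_sum_of_subset_of_nonneg hG fun _ _ _ => sq_nonneg _
  rcases le_total m ((u + v) / 2) with h | h
  · refine group (Finset.range ((k + 15) / 16)) (Finset.range_subset_range.2 (by omega))
      (by rw [Finset.card_range]; omega) fun j hj => ?_
    have := hu j (by rw [Finset.mem_range] at hj; omega)
    apply pow_le_pow_left₀ <;> linarith
  · refine group (Finset.Ico ((k + 1) / 2) k) (fun j hj => ?_)
      (by rw [Nat.card_Ico]; omega) fun j hj => ?_
    · rw [Finset.mem_Ico] at hj; exact Finset.mem_range.2 hj.2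
    · rw [Finset.mem_Ico] at hj
      have := hv j hj.2 (by omega)
      rw [← neg_sq (s j - m)]
      apply pow_le_pow_left₀ <;> linarith

end Spread

/-! ### The mean excess of `log Y` -/

section LogExcess

variable {ν : Measure ℝ} [IsProbabilityMeasure ν] {a : ℝ → ℝ} {γ : ℝ}

/-- The mean excess of `log Y` over `log U(t/2)` is `O(a(t) / (t U(t)))`.  The excess is bounded by
the sum of the dyadic increments of `log U` over the levels `U(2^m t/2)` that `Y` exceeds; level
`m` is exceeded with probability at most `2^(1-m) / t`, and the increments grow at most like
`(3/2)^m`. -/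
lemma lintegral_log_excess_le (h0 : ν (Set.Iic 0) = 0) (h : IsERV (tailQuantile ν) γ a) :
    ∃ C > 0, ∀ᶠ t in atTop,
      ∫⁻ y, ENNReal.ofReal (Real.log y - Real.log (tailQuantile ν (t / 2))) ∂ν ≤
        ENNReal.ofReal (C * (a t / tailQuantile ν t) / t) := by
  have hpos : ∀ t, 1 < t → 0 < tailQuantile ν t := fun t ht => tailQuantile_pos ν h0 ht
  have hmono : ∀ s t, 1 < s → s ≤ t → tailQuantile ν s ≤ tailQuantile ν t :=
    fun s t hs hst => tailQuantile_le_tailQuantile ν hs hst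
  obtain ⟨C, hC, H⟩ := h.log_dyadic_increment_le hpos hmono
  refine ⟨8 * C, by positivity, ?_⟩
  filter_upwards [H, h.1, eventually_gt_atTop 2] with t hD hat ht
  set u : ℕ → ℝ := fun m => tailQuantile ν (t / 2 * 2 ^ m) with hu
  have hlev : ∀ m : ℕ, 1 < t / 2 * 2 ^ m := fun m =>
    lt_of_lt_of_le (by linarith) (le_mul_of_one_le_right (by linarith)
      (one_le_pow₀ one_le_two) : t / 2 ≤ _)
  have hu0 : ∀ m, 0 < u m := fun m => hpos _ (hlev m)
  have hum : ∀ m, u m ≤ u (m + 1) := fun m => hmono _ _ (hlev m) (by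
    gcongr
    · exact one_le_two
    · omega)
  set D : ℕ → ℝ := fun m => Real.log (u (m + 1)) - Real.log (u m) with hDdef
  have hD0 : ∀ m, 0 ≤ D m := fun m => sub_nonneg.2 (Real.log_le_log (hu0 m) (hum m))
  have hU : tailQuantile ν (t / 2) = u 0 := by simp [hu]
  set A := a t / tailQuantile ν t with hA
  have hA0 : 0 < A := div_pos hat (hpos t (by linarith))
  have htail : ∀ m, ν (Set.Ioi (u m)) ≤ ENNReal.ofReal (1 / (t / 2 * 2 ^ m)) := fun m => by
    rw [← ofReal_measureReal]
    exact ENNReal.ofReal_le_ofReal (measureReal_Ioi_tailQuantile_le ν (hlev m))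
  have hreach : ∀ᵐ y ∂ν, ∃ m, y ≤ u m := by
    rw [ae_iff]
    have hlim : Tendsto (fun m : ℕ => ENNReal.ofReal (1 / (t / 2 * 2 ^ m))) atTop (𝓝 0) := by
      rw [← ENNReal.ofReal_zero]
      refine ENNReal.tendsto_ofReal (tendsto_const_nhds.div_atTop ?_)
      exact (tendsto_pow_atTop_atTop_of_one_lt one_lt_two).const_mul_atTop (by linarith)
    refine le_antisymm (ge_of_tendsto hlim (Eventually.of_forall fun m => ?_)) zero_le
    refine (measure_mono fun y hy => ?_).trans (htail m)
    simp only [Set.mem_ofPred_eq, not_exists, not_le] at hy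
    exact hy m
  have hptw : ∀ᵐ y ∂ν, ENNReal.ofReal (Real.log y - Real.log (u 0)) ≤
      ∑' m, (Set.Ioi (u m)).indicator (fun _ => ENNReal.ofReal (D m)) y := by
    have hy0 : ∀ᵐ y ∂ν, 0 < y := by
      rw [ae_iff]
      simpa [Set.Iic] using h0
    filter_upwards [hreach, hy0] with y hy hy0
    classical
    set m := Nat.find hy with hm
    have h1 : y ≤ u m := Nat.find_spec hy
    have h2 : ∀ i ∈ Finset.range m, u i < y := fun i hi =>
      not_le.1 (Nat.find_min hy (Finset.mem_range.1 hi))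
    calc _ ≤ ENNReal.ofReal (∑ i ∈ Finset.range m, D i) := by
          apply ENNReal.ofReal_le_ofReal
          rw [hDdef, Finset.sum_range_sub (fun i => Real.log (u i))]
          have := Real.log_le_log hy0 h1
          linarith
      _ = ∑ i ∈ Finset.range m, ENNReal.ofReal (D i) :=
          ENNReal.ofReal_sum_of_nonneg fun i _ => hD0 i
      _ = ∑ i ∈ Finset.range m, (Set.Ioi (u i)).indicator (fun _ => ENNReal.ofReal (D i)) y :=
          Finset.sum_congr rfl fun i hi => by rw [Set.indicator_of_mem (Set.mem_Ioi.2 (h2 i hi))]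
      _ ≤ _ := ENNReal.sum_le_tsum _
  rw [hU]
  calc _ ≤ _ := lintegral_mono_ae hptw
    _ = ∑' m, ENNReal.ofReal (D m) * ν (Set.Ioi (u m)) := by
        rw [lintegral_tsum fun m => (measurable_const.indicator measurableSet_Ioi).aemeasurable]
        simp only [lintegral_indicator_const measurableSet_Ioi]
    _ ≤ ∑' m : ℕ, ENNReal.ofReal (2 * C * A / t * (3 / 4) ^ m) := by
        refine ENNReal.tsum_le_tsum fun m => ?_
        calc _ ≤ ENNReal.ofReal (C * (3 / 2) ^ m * A) *
              ENNReal.ofReal (1 / (t / 2 * 2 ^ m)) := by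
              gcongr
              · exact hD m
              · exact htail m
          _ = _ := by
              rw [← ENNReal.ofReal_mul (by positivity)]
              congr 1
              rw [show (3 / 4 : ℝ) = 3 / 2 / 2 by norm_num, div_pow (3 / 2 : ℝ) 2]
              field_simp
    _ = ENNReal.ofReal (∑' m : ℕ, 2 * C * A / t * (3 / 4) ^ m) :=
        (ENNReal.ofReal_tsum_of_nonneg (fun m => by positivity)
          ((summable_geometric_of_lt_one (by norm_num) (by norm_num)).mul_left _)).symm
    _ = _ := by
        rw [tsum_mul_left, tsum_geometric_of_lt_one (by norm_num) (by norm_num)]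
        congr 1
        ring

end LogExcess

/-! ### Intermediate sequences -/

section IntermediateSequence

variable {k : ℕ → ℕ}

lemma eventually_lt_of_div_tendsto_zero
    (hkn : Tendsto (fun n => (k n : ℝ) / (n : ℝ)) atTop (𝓝 0)) : ∀ᶠ n in atTop, k n < n := by
  filter_upwards [hkn.eventually (gt_mem_nhds one_pos), eventually_gt_atTop 0] with n h1 h2
  rw [div_lt_one (by exact_mod_cast h2)] at h1
  exact_mod_cast h1

lemma tendsto_div_atTop (hk : Tendsto k atTop atTop)
    (hkn : Tendsto (fun n => (k n : ℝ) / (n : ℝ)) atTop (𝓝 0)) :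
    Tendsto (fun n : ℕ => (n : ℝ) / (k n : ℝ)) atTop atTop := by
  have h1 : Tendsto (fun n => (k n : ℝ) / (n : ℝ)) atTop (𝓝[>] 0) := by
    refine tendsto_nhdsWithin_iff.2 ⟨hkn, ?_⟩
    filter_upwards [hk.eventually_gt_atTop 0, eventually_gt_atTop 0] with n h2 h3
    have h2' : (0 : ℝ) < k n := by exact_mod_cast h2
    have h3' : (0 : ℝ) < n := by exact_mod_cast h3
    exact div_pos h2' h3'
  refine h1.inv_tendsto_nhdsGT_zero.congr fun n => ?_
  simp

end IntermediateSequence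

/-! ### Orders of magnitude of the sample statistics -/

section Sample

variable {Ω : Type*} [MeasurableSpace Ω] {P : Measure Ω}
  {ν : Measure ℝ} [IsProbabilityMeasure ν] {X : (n : ℕ) → Fin n → Ω → ℝ} {k : ℕ → ℕ}
  {a : ℝ → ℝ} {γ : ℝ}

lemma tendsto_ofReal_div_natCast (hk : Tendsto k atTop atTop) (c : ℝ) :
    Tendsto (fun n => ENNReal.ofReal (c / k n)) atTop (𝓝 0) := by
  rw [← ENNReal.ofReal_zero]
  exact ENNReal.tendsto_ofReal
    (tendsto_const_nhds.div_atTop (tendsto_natCast_atTop_atTop.comp hk))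

/-- Markov's inequality for the total excess of `log X` over `log U(n/(2k))`. -/
lemma asympCertain_log_excess_le (hX : ∀ n l, AEMeasurable (X n l) P)
    (hν : ∀ n l, P.map (X n l) = ν) (h0 : ν (Set.Iic 0) = 0)
    (h : IsERV (tailQuantile ν) γ a)
    (hk : Tendsto k atTop atTop) (hkn : Tendsto (fun n => (k n : ℝ) / (n : ℝ)) atTop (𝓝 0)) :
    AsympCertain P fun (B : ℝ) n ω =>
      ∑ l, max (Real.log (X n l ω) - Real.log (tailQuantile ν ((n : ℝ) / (k n : ℝ) / 2))) 0 ≤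
        k n * (B * (a ((n : ℝ) / (k n : ℝ)) / tailQuantile ν ((n : ℝ) / (k n : ℝ)))) := by
  obtain ⟨C, hC, H⟩ := lintegral_log_excess_le h0 h
  intro ε hε
  have hlim : Tendsto (fun B : ℝ => ENNReal.ofReal (C / B)) atTop (𝓝 0) := by
    rw [← ENNReal.ofReal_zero]
    exact ENNReal.tendsto_ofReal (tendsto_const_nhds.div_atTop tendsto_id)
  obtain ⟨B, hB, hB0⟩ := ((hlim.eventually (gt_mem_nhds hε)).and (eventually_gt_atTop 0)).exists
  refine ⟨B, ?_⟩
  have hT := tendsto_div_atTop hk hkn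
  filter_upwards [hT.eventually H, hT.eventually h.1, hT.eventually_gt_atTop 1,
    hk.eventually_gt_atTop 0, eventually_gt_atTop 0] with n h1 h2 h3 h4 h5
  have hk0 : (0 : ℝ) < k n := by exact_mod_cast h4
  have hn0 : (0 : ℝ) < n := by exact_mod_cast h5
  have hA : 0 < a ((n : ℝ) / k n) / tailQuantile ν ((n : ℝ) / k n) :=
    div_pos h2 (tailQuantile_pos ν h0 h3)
  set A := a ((n : ℝ) / k n) / tailQuantile ν ((n : ℝ) / k n) with hAdef
  set u := Real.log (tailQuantile ν ((n : ℝ) / (k n : ℝ) / 2)) with hu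
  have hf : Measurable fun y : ℝ => ENNReal.ofReal (Real.log y - u) :=
    (Real.measurable_log.sub_const _).ennreal_ofReal
  set S : Ω → ℝ≥0∞ := fun ω => ∑ l, ENNReal.ofReal (Real.log (X n l ω) - u) with hS
  have hSm : AEMeasurable S P := by
    refine Finset.aemeasurable_fun_sum _ fun l _ => ?_
    exact hf.comp_aemeasurable (hX n l)
  have hES : ∫⁻ ω, S ω ∂P ≤ ENNReal.ofReal (k n * (C * A)) := by
    rw [hS, lintegral_finsetSum' (f := fun l ω => ENNReal.ofReal (Real.log (X n l ω) - u)) _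
      fun l _ => hf.comp_aemeasurable (hX n l)]
    have : ∀ l, ∫⁻ ω, ENNReal.ofReal (Real.log (X n l ω) - u) ∂P ≤
        ENNReal.ofReal (C * A / (n / k n)) := fun l => by
      rw [← lintegral_map' hf.aemeasurable (hX n l), hν n l]
      exact h1
    calc _ ≤ ∑ _l : Fin n, ENNReal.ofReal (C * A / (n / k n)) := Finset.sum_le_sum fun l _ => this l
      _ = ENNReal.ofReal (n * (C * A / (n / k n))) := by
        rw [ENNReal.ofReal_mul hn0.le]; simp
      _ = _ := by congr 1; field_simp
  have hb : 0 < k n * (B * A) := by positivity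
  refine le_trans ?_ hB.le
  calc _ ≤ P {ω | ENNReal.ofReal (k n * (B * A)) ≤ S ω} := measure_mono fun ω hω => by
        simp only [Set.mem_ofPred_eq, not_le] at hω ⊢
        refine (ENNReal.ofReal_le_ofReal hω.le).trans (le_of_eq ?_)
        rw [ENNReal.ofReal_sum_of_nonneg fun l _ => le_max_right _ _]
        refine Finset.sum_congr rfl fun l _ => ?_
        rw [ENNReal.ofReal_max, ENNReal.ofReal_zero, max_eq_left zero_le]
    _ ≤ (∫⁻ ω, S ω ∂P) / ENNReal.ofReal (k n * (B * A)) :=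
        meas_ge_le_lintegral_div hSm (ENNReal.ofReal_pos.2 hb).ne' ENNReal.ofReal_ne_top
    _ ≤ ENNReal.ofReal (k n * (C * A)) / ENNReal.ofReal (k n * (B * A)) := by gcongr
    _ = _ := by
        rw [← ENNReal.ofReal_div_of_pos hb]
        congr 1
        field_simp

variable [IsProbabilityMeasure P]

/-- More than half of the expected number of observations reach the level `U(x n / k)`. -/
lemma asympCertain_lt_card_ge (hX : ∀ n l, AEMeasurable (X n l) P)
    (hind : ∀ n, iIndepFun (X n) P) (hν : ∀ n l, P.map (X n l) = ν)
    (hk : Tendsto k atTop atTop) (hkn : Tendsto (fun n => (k n : ℝ) / (n : ℝ)) atTop (𝓝 0))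
    {x : ℝ} (hx : 0 < x) :
    AsympCertain P fun (_ : Unit) n ω => (k n : ℝ) / (2 * x) <
      (Finset.univ.filter fun l =>
        tailQuantile ν ((n : ℝ) / (k n : ℝ) * x) ≤ X n l ω).card := by
  classical
  refine asympCertain_of_tendsto (tendsto_ofReal_div_natCast hk (4 * x)) ?_
  filter_upwards [hk.eventually_gt_atTop 0, eventually_gt_atTop 0,
    ((tendsto_div_atTop hk hkn).atTop_mul_const hx).eventually_gt_atTop 1] with n h1 h2 h3
  have hk0 : (0 : ℝ) < k n := by exact_mod_cast h1
  have hn0 : (0 : ℝ) < n := by exact_mod_cast h2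
  set S := Set.Ici (tailQuantile ν ((n : ℝ) / (k n : ℝ) * x)) with hS
  have hq : k n / x ≤ n * ν.real S := by
    have := mul_le_mul_of_nonneg_left (le_measureReal_Ici_tailQuantile ν h3) hn0.le
    refine le_trans (le_of_eq ?_) this
    field_simp
  set m := n * ν.real S with hm
  have hm0 : 0 < m := lt_of_lt_of_le (by positivity) hq
  have key := measure_count_deviation_le (hX n) (hind n) (hν n)
    (measurableSet_Ici : MeasurableSet S) (half_pos hm0)
  refine (measure_mono fun ω hω => ?_).trans (key.trans (ENNReal.ofReal_le_ofReal ?_))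
  · simp only [Set.mem_ofPred_eq, not_lt] at hω
    rw [Set.mem_ofPred_eq, le_abs]
    right
    have h4 : (k n : ℝ) / (2 * x) = k n / x / 2 := by field_simp
    have h5 : (((Finset.univ.filter fun l => X n l ω ∈ S).card : ℕ) : ℝ) ≤ k n / (2 * x) := hω
    rw [h4] at h5
    linarith
  · rw [← hm, show m / (m / 2) ^ 2 = 4 / m by field_simp; norm_num, div_le_div_iff₀ hm0 hk0]
    rw [div_le_iff₀ hx] at hq
    linarith

/-- At most twice the expected number of observations exceed the level `U(x n / k)`. -/
lemma asympCertain_card_gt_le (hX : ∀ n l, AEMeasurable (X n l) P)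
    (hind : ∀ n, iIndepFun (X n) P) (hν : ∀ n l, P.map (X n l) = ν)
    (hk : Tendsto k atTop atTop) (hkn : Tendsto (fun n => (k n : ℝ) / (n : ℝ)) atTop (𝓝 0))
    {x : ℝ} (hx : 0 < x) :
    AsympCertain P fun (_ : Unit) n ω =>
      ((Finset.univ.filter fun l =>
        tailQuantile ν ((n : ℝ) / (k n : ℝ) * x) < X n l ω).card : ℝ) ≤ 2 * k n / x := by
  classical
  refine asympCertain_of_tendsto (tendsto_ofReal_div_natCast hk x) ?_
  filter_upwards [hk.eventually_gt_atTop 0, eventually_gt_atTop 0,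
    ((tendsto_div_atTop hk hkn).atTop_mul_const hx).eventually_gt_atTop 1] with n h1 h2 h3
  have hk0 : (0 : ℝ) < k n := by exact_mod_cast h1
  have hn0 : (0 : ℝ) < n := by exact_mod_cast h2
  set S := Set.Ioi (tailQuantile ν ((n : ℝ) / (k n : ℝ) * x)) with hS
  have hq : n * ν.real S ≤ k n / x := by
    have := mul_le_mul_of_nonneg_left (measureReal_Ioi_tailQuantile_le ν h3) hn0.le
    refine this.trans (le_of_eq ?_)
    field_simp
  have hc : 0 < (k n : ℝ) / x := by positivity
  have key := measure_count_deviation_le (hX n) (hind n) (hν n)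
    (measurableSet_Ioi : MeasurableSet S) hc
  refine (measure_mono fun ω hω => ?_).trans (key.trans (ENNReal.ofReal_le_ofReal ?_))
  · simp only [Set.mem_ofPred_eq, not_le] at hω
    rw [Set.mem_ofPred_eq, le_abs]
    left
    have h5 : 2 * k n / x < (((Finset.univ.filter fun l => X n l ω ∈ S).card : ℕ) : ℝ) := hω
    rw [mul_div_assoc] at h5
    linarith
  · calc _ ≤ (k n / x) / (k n / x : ℝ) ^ 2 := by gcongr
      _ = x / k n := by field_simp

/-- Location of the upper order statistics: the top `k/16` lie above `U(8n/k)`, those of rank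
between `k/2` and `k` from the top lie below `U(4n/k)`, and the threshold `X_{n-k,n}` lies above
`U(n/(2k))`. -/
lemma asympCertain_orderStat_location (hX : ∀ n l, AEMeasurable (X n l) P)
    (hind : ∀ n, iIndepFun (X n) P) (hν : ∀ n l, P.map (X n l) = ν)
    (hk : Tendsto k atTop atTop) (hkn : Tendsto (fun n => (k n : ℝ) / (n : ℝ)) atTop (𝓝 0)) :
    AsympCertain P fun (_ : Unit) n ω =>
      (∀ j, 16 * j < k n → tailQuantile ν ((n : ℝ) / (k n : ℝ) * 8) ≤
        orderStat (fun l => X n l ω) (n - j)) ∧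
      (∀ j, j ≤ k n → k n ≤ 2 * j → orderStat (fun l => X n l ω) (n - j) ≤
        tailQuantile ν ((n : ℝ) / (k n : ℝ) * 4)) ∧
      tailQuantile ν ((n : ℝ) / (k n : ℝ) / 2) ≤ orderStat (fun l => X n l ω) (n - k n) := by
  have E1 := asympCertain_lt_card_ge hX hind hν hk hkn (x := 8) (by norm_num)
  have E2 := asympCertain_lt_card_ge hX hind hν hk hkn (x := 1 / 2) (by norm_num)
  have E3 := asympCertain_card_gt_le hX hind hν hk hkn (x := 4) (by norm_num)
  refine ((E1.and E2).and E3).mono fun _ => ⟨(), ?_⟩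
  filter_upwards [eventually_lt_of_div_tendsto_zero hkn] with n hn
  refine Eventually.of_forall fun ω => ?_
  rintro ⟨⟨h1, h2⟩, h3⟩
  refine ⟨fun j hj => le_orderStat_sub (by omega) ?_, fun j hj hj2 =>
    orderStat_sub_le (by omega) ?_, le_orderStat_sub hn ?_⟩
  · have : (16 * j : ℝ) < k n := by exact_mod_cast hj
    have h4 : (j : ℝ) < _ := lt_trans (by linarith) h1
    exact_mod_cast h4
  · have : (k n : ℝ) ≤ 2 * j := by exact_mod_cast hj2
    have h4 : _ ≤ (j : ℝ) := h3.trans (by linarith)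
    exact_mod_cast h4
  · norm_num at h2
    simpa [div_eq_mul_inv] using h2

/-- Orders of magnitude, relative to `A = a(n/k) / U(n/k)`, of the statistics that enter the moment
estimator: the threshold is `O(U(n/k))`, the Hill estimator is `O(A)`, and the empirical variance
of the log-spacings is at least of order `A²`. -/
theorem exists_asympCertain_logMoment_bounds (hX : ∀ n l, AEMeasurable (X n l) P)
    (hind : ∀ n, iIndepFun (X n) P) (hν : ∀ n l, P.map (X n l) = ν) (h0 : ν (Set.Iic 0) = 0)
    (h : IsERV (tailQuantile ν) γ a)
    (hk : Tendsto k atTop atTop) (hkn : Tendsto (fun n => (k n : ℝ) / (n : ℝ)) atTop (𝓝 0)) :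
    ∃ c > 0, ∃ C > 0, AsympCertain P fun (B : ℝ) n ω =>
      orderStat (fun l => X n l ω) (n - k n) ≤ C * tailQuantile ν ((n : ℝ) / (k n : ℝ)) ∧
      logMoment (k n) 1 (fun l => X n l ω) ≤
        B * (a ((n : ℝ) / (k n : ℝ)) / tailQuantile ν ((n : ℝ) / (k n : ℝ))) ∧
      c * (a ((n : ℝ) / (k n : ℝ)) / tailQuantile ν ((n : ℝ) / (k n : ℝ))) ^ 2 ≤
        logMoment (k n) 2 (fun l => X n l ω) - logMoment (k n) 1 (fun l => X n l ω) ^ 2 := by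
  have hpos : ∀ t, 1 < t → 0 < tailQuantile ν t := fun t ht => tailQuantile_pos ν h0 ht
  obtain ⟨c, hc, Hc⟩ := h.le_log_increment hpos
  obtain ⟨C, hC, HC⟩ := h.le_const_mul hpos (x := 4) (by norm_num)
  refine ⟨c ^ 2 / 64, by positivity, C, hC, ?_⟩
  have E1 := asympCertain_orderStat_location hX hind hν hk hkn
  have E2 := asympCertain_log_excess_le hX hν h0 h hk hkn
  refine (E1.and E2).mono fun b => ⟨b.2, ?_⟩
  have hT := tendsto_div_atTop hk hkn
  filter_upwards [hT.eventually Hc, hT.eventually HC, hT.eventually h.1, hT.eventually_gt_atTop 2,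
    hk.eventually_ge_atTop 2, eventually_lt_of_div_tendsto_zero hkn] with n h1 h2 h3 h4 h5 h6
  refine Eventually.of_forall fun ω => ?_
  rintro ⟨⟨l1, l2, l3⟩, l4⟩
  have hk0 : (0 : ℝ) < k n := by exact_mod_cast (show 0 < k n by omega)
  have hU2 := hpos ((n : ℝ) / k n / 2) (by linarith)
  have hU4 := hpos ((n : ℝ) / k n * 4) (by linarith)
  have hU8 := hpos ((n : ℝ) / k n * 8) (by linarith)
  have hA0 : 0 < a ((n : ℝ) / k n) / tailQuantile ν ((n : ℝ) / k n) :=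
    div_pos h3 (hpos _ (by linarith))
  set A := a ((n : ℝ) / k n) / tailQuantile ν ((n : ℝ) / k n) with hA
  set x : Fin n → ℝ := fun l => X n l ω with hx
  have hge : ∀ j, j ≤ k n → orderStat x (n - k n) ≤ orderStat x (n - j) := fun j hj =>
    orderStat_le_orderStat x (by omega) (by omega) (by omega)
  have hx0 : ∀ j, j ≤ k n → 0 < orderStat x (n - j) := fun j hj =>
    hU2.trans_le (l3.trans (hge j hj))
  refine ⟨(l2 _ le_rfl (by omega)).trans h2, ?_, ?_⟩
  · have h7 := sum_orderStat_le x h6.le (f := fun y => max (Real.log y -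
      Real.log (tailQuantile ν ((n : ℝ) / (k n : ℝ) / 2))) 0) fun y => le_max_right _ _
    have h8 := h7.trans l4
    rw [logMoment, one_div, inv_mul_le_iff₀ hk0]
    refine le_trans (Finset.sum_le_sum fun j hj => ?_) h8
    rw [pow_one]
    refine le_trans ?_ (le_max_left _ _)
    have := Real.log_le_log hU2 l3
    linarith
  · have huv : c * A ≤ (Real.log (tailQuantile ν ((n : ℝ) / k n * 8)) -
          Real.log (orderStat x (n - k n))) -
        (Real.log (tailQuantile ν ((n : ℝ) / k n * 4)) - Real.log (orderStat x (n - k n))) := by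
      linarith
    have hcA : 0 < c * A := by positivity
    have key := sq_div_le_empirical_variance h5
      (s := fun j => Real.log (orderStat x (n - j)) - Real.log (orderStat x (n - k n)))
      (sub_nonneg.1 (hcA.le.trans huv))
      (fun j hj => sub_le_sub_right (Real.log_le_log hU8 (l1 j hj)) _)
      (fun j hj hj2 => sub_le_sub_right (Real.log_le_log (hx0 j hj.le) (l2 j hj.le hj2)) _)
    simp only [logMoment, pow_one]
    refine le_trans ?_ key
    have := pow_le_pow_left₀ hcA.le huv 2
    rw [mul_pow] at this
    linarith

end Sample

/-! ### Stability of the estimators under relative perturbations -/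

section Perturbation

lemma abs_log_sub_log_le {x x' δ : ℝ} (hx : 0 < x) (hδ : δ ≤ 1 / 2) (h : |x' / x - 1| ≤ δ) :
    |Real.log x' - Real.log x| ≤ 2 * δ := by
  rw [abs_le] at h
  have hr : 1 / 2 ≤ x' / x := by linarith
  have hr0 : 0 < x' / x := by linarith
  have hx' : 0 < x' := (div_pos_iff_of_pos_right hx).1 hr0
  rw [← Real.log_div hx'.ne' hx.ne', abs_le]
  constructor
  · have h1 := Real.one_sub_inv_le_log_of_pos hr0
    have h2 : (x' / x)⁻¹ - 1 ≤ 2 * δ := by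
      rw [← one_div, div_sub_one hr0.ne', div_le_iff₀ hr0]
      nlinarith
    linarith
  · have := Real.log_le_sub_one_of_pos hr0
    linarith

lemma abs_mean_sub_mean_le {k : ℕ} (hk : 0 < k) {f g b : ℕ → ℝ}
    (h : ∀ j ∈ Finset.range k, |f j - g j| ≤ b j) :
    |(1 / (k : ℝ)) * ∑ j ∈ Finset.range k, f j - (1 / (k : ℝ)) * ∑ j ∈ Finset.range k, g j| ≤
      (1 / (k : ℝ)) * ∑ j ∈ Finset.range k, b j := by
  have hk0 : (0 : ℝ) < 1 / k := by positivity
  rw [← mul_sub, ← Finset.sum_sub_distrib, abs_mul, abs_of_pos hk0]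
  gcongr
  exact (Finset.abs_sum_le_sum_abs _ _).trans (Finset.sum_le_sum h)

variable {n k : ℕ} {x x' : Fin n → ℝ}

lemma logMoment_one_nonneg (hk : k < n) (hx : ∀ l, 0 < x l) : 0 ≤ logMoment k 1 x := by
  unfold logMoment
  refine mul_nonneg (by positivity) (Finset.sum_nonneg fun j hj => ?_)
  have hj := Finset.mem_range.1 hj
  rw [pow_one, sub_nonneg]
  obtain ⟨l, hl⟩ := exists_orderStat_eq x (i := n - k) (by omega) (by omega)
  exact Real.log_le_log (by rw [hl]; exact hx l)
    (orderStat_le_orderStat x (by omega) (by omega) (by omega))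

lemma abs_logMoment_sub_le (hk0 : 0 < k) (hk : k < n) (hx : ∀ l, 0 < x l) {δ : ℝ}
    (hδ : δ ≤ 1 / 2) (h : ∀ j ≤ k, |orderStat x' (n - j) / orderStat x (n - j) - 1| ≤ δ) :
    |logMoment k 1 x' - logMoment k 1 x| ≤ 4 * δ ∧
    |logMoment k 2 x' - logMoment k 2 x| ≤ 4 * δ * (2 * logMoment k 1 x + 4 * δ) := by
  have hkR : (0 : ℝ) < k := by exact_mod_cast hk0
  have hpos : ∀ j ≤ k, 0 < orderStat x (n - j) := fun j hj => by
    obtain ⟨l, hl⟩ := exists_orderStat_eq x (i := n - j) (by omega) (by omega)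
    rw [hl]; exact hx l
  have hlog : ∀ j ≤ k, |Real.log (orderStat x' (n - j)) - Real.log (orderStat x (n - j))| ≤ 2 * δ :=
    fun j hj => abs_log_sub_log_le (hpos j hj) hδ (h j hj)
  set s : ℕ → ℝ := fun j => Real.log (orderStat x (n - j)) - Real.log (orderStat x (n - k)) with hs
  set s' : ℕ → ℝ := fun j =>
    Real.log (orderStat x' (n - j)) - Real.log (orderStat x' (n - k)) with hs'
  have hs0 : ∀ j ≤ k, 0 ≤ s j := fun j hj => sub_nonneg.2 (Real.log_le_log (hpos k le_rfl)
    (orderStat_le_orderStat x (by omega) (by omega) (by omega)))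
  have hd : ∀ j ≤ k, |s' j - s j| ≤ 4 * δ := fun j hj => by
    have h1 := abs_le.1 (hlog j hj)
    have h2 := abs_le.1 (hlog k le_rfl)
    rw [abs_le]
    simp only [hs, hs']
    constructor <;> linarith
  have e1 : ∀ y : Fin n → ℝ, logMoment k 1 y = (1 / (k : ℝ)) * ∑ j ∈ Finset.range k,
      (Real.log (orderStat y (n - j)) - Real.log (orderStat y (n - k))) := fun y => by
    simp only [logMoment, pow_one]
  constructor
  · rw [e1, e1]
    refine (abs_mean_sub_mean_le hk0 (b := fun _ => 4 * δ) fun j hj =>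
      hd j (Finset.mem_range.1 hj).le).trans (le_of_eq ?_)
    simp only [Finset.sum_const, Finset.card_range, nsmul_eq_mul]
    field_simp
  · rw [e1, logMoment, logMoment]
    refine (abs_mean_sub_mean_le hk0 (b := fun j => 4 * δ * (2 * s j + 4 * δ)) fun j hj => ?_).trans
      (le_of_eq ?_)
    · have hj := (Finset.mem_range.1 hj).le
      have h1 := hd j hj
      have h2 : |s' j + s j| ≤ 2 * s j + 4 * δ := by
        have := abs_le.1 h1
        have := hs0 j hj
        rw [abs_le]; constructor <;> linarith
      rw [sq_sub_sq, abs_mul, mul_comm]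
      exact mul_le_mul h1 h2 (abs_nonneg _) ((abs_nonneg _).trans h1)
    · rw [← Finset.mul_sum, Finset.sum_add_distrib, ← Finset.mul_sum]
      simp only [Finset.sum_const, Finset.card_range, nsmul_eq_mul, hs]
      field_simp

lemma one_sub_gammaMinus (h : 0 < logMoment k 2 x) :
    1 - gammaMinus k x = 1 / 2 * (logMoment k 2 x / (logMoment k 2 x - logMoment k 1 x ^ 2)) := by
  rw [gammaMinus, one_sub_div h.ne', inv_div]
  ring

/-- Stability of `m₂ / (m₂ - m₁²)` under perturbations of the two moments, on the scale `A` and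
away from the singularity `m₂ = m₁²`. -/
lemma exists_moment_ratio_bounds {c B : ℝ} (hc : 0 < c) (hB : 0 < B) :
    ∃ K > 0, ∃ η > 0, ∀ A m₁ m₂ m₁' m₂' e : ℝ, 0 < A → 0 ≤ m₁ → m₁ ≤ B * A →
      c * A ^ 2 ≤ m₂ - m₁ ^ 2 → 0 ≤ e → e ≤ η * A → |m₁' - m₁| ≤ e →
      |m₂' - m₂| ≤ e * (2 * m₁ + e) →
      0 < m₂ ∧ 0 < m₂' ∧ |m₂ / (m₂ - m₁ ^ 2)| ≤ K ∧
        |m₂' / (m₂' - m₁' ^ 2) - m₂ / (m₂ - m₁ ^ 2)| ≤ K * (e / A) := by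
  set R := 1 + B ^ 2 / c with hR
  refine ⟨(2 * B + 1) * (1 + 2 * R) * (2 / c) + R, by positivity,
    min 1 (c / (4 * (2 * B + 1))), by positivity, ?_⟩
  intro A m₁ m₂ m₁' m₂' e hA h0 h1 h2 he heA h3 h4
  have he1 : e ≤ A := heA.trans (by
    have := mul_le_mul_of_nonneg_right (min_le_left 1 (c / (4 * (2 * B + 1)))) hA.le
    linarith)
  have he2 : e * (4 * (2 * B + 1)) ≤ c * A := by
    have h5 := heA.trans (mul_le_mul_of_nonneg_right (min_le_right 1 (c / (4 * (2 * B + 1)))) hA.le)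
    rw [div_mul_eq_mul_div, le_div_iff₀ (by positivity)] at h5
    exact h5
  have h5 : e * (2 * m₁ + e) ≤ e * ((2 * B + 1) * A) := by
    gcongr; linarith
  set V := m₂ - m₁ ^ 2 with hV
  set V' := m₂' - m₁' ^ 2 with hV'
  have hV0 : 0 < V := lt_of_lt_of_le (by positivity) h2
  have h6 : |V' - V| ≤ 2 * (e * ((2 * B + 1) * A)) := by
    have h7 : |m₁' ^ 2 - m₁ ^ 2| ≤ e * (2 * m₁ + e) := by
      rw [sq_sub_sq, abs_mul, mul_comm]
      refine mul_le_mul h3 ?_ (abs_nonneg _) he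
      have := abs_le.1 h3
      rw [abs_le]; constructor <;> linarith
    have h8 := abs_le.1 h4
    have h9 := abs_le.1 h7
    rw [abs_le]
    constructor <;> linarith
  have h7 : c * A ^ 2 / 2 ≤ V' := by
    have h8 := (abs_le.1 h6).1
    have h9 := mul_le_mul_of_nonneg_right he2 hA.le
    nlinarith
  have hV'0 : 0 < V' := lt_of_lt_of_le (by positivity) h7
  have hm2 : 0 < m₂ := by nlinarith [sq_nonneg m₁]
  have hm2' : 0 < m₂' := by nlinarith [sq_nonneg m₁']
  have h8 : m₂ / V ≤ R := by
    have h9 : m₁ ^ 2 ≤ B ^ 2 / c * V := by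
      calc m₁ ^ 2 ≤ (B * A) ^ 2 := pow_le_pow_left₀ h0 h1 2
        _ = B ^ 2 / c * (c * A ^ 2) := by field_simp
        _ ≤ _ := by gcongr
    rw [div_le_iff₀ hV0, hR]
    linarith
  have h80 : 0 ≤ m₂ / V := by positivity
  have hR0 : 0 < R := by positivity
  refine ⟨hm2, hm2', ?_, ?_⟩
  · rw [abs_of_nonneg h80]
    refine h8.trans (le_add_of_nonneg_left (by positivity))
  · have h9 : m₂' / V' - m₂ / V = ((m₂' - m₂) - m₂ / V * (V' - V)) / V' := by
      field_simp
      ring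
    have h10 : |(m₂' - m₂) - m₂ / V * (V' - V)| ≤ e * ((2 * B + 1) * A) * (1 + 2 * R) := by
      calc _ ≤ |m₂' - m₂| + |m₂ / V * (V' - V)| := abs_sub _ _
        _ ≤ e * ((2 * B + 1) * A) + R * (2 * (e * ((2 * B + 1) * A))) := by
          rw [abs_mul, abs_of_nonneg h80]
          gcongr
          exact h4.trans h5
        _ = _ := by ring
    rw [h9, abs_div, abs_of_pos hV'0]
    calc _ ≤ e * ((2 * B + 1) * A) * (1 + 2 * R) / (c * A ^ 2 / 2) := by gcongr
      _ = (2 * B + 1) * (1 + 2 * R) * (2 / c) * (e / A) := by field_simp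
      _ ≤ _ := by
        have : 0 ≤ e / A := by positivity
        gcongr
        linarith

/-- A relative perturbation of size `ζ A` of the upper order statistics changes the moment
estimator, the threshold and the scale estimator by `O(ζ)`, the last two relative to `A U`, as soon
as the sample satisfies the bounds of `exists_asympCertain_logMoment_bounds`. -/
theorem exists_perturbation_bounds {c B C D : ℝ} (hc : 0 < c) (hB : 0 < B) (hC : 0 < C)
    (hD : 0 < D) :
    ∃ K > 0, ∃ η > 0, ∀ (n k : ℕ) (x x' : Fin n → ℝ) (A U ζ : ℝ), 0 < k → k < n →
      (∀ l, 0 < x l) → 0 < U → 0 < A → A ≤ D → orderStat x (n - k) ≤ C * U →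
      logMoment k 1 x ≤ B * A → c * A ^ 2 ≤ logMoment k 2 x - logMoment k 1 x ^ 2 →
      0 ≤ ζ → ζ ≤ η → maxRelError k x' x ≤ ζ * A →
      |gammaMoment k x' - gammaMoment k x| ≤ K * ζ ∧
      |orderStat x' (n - k) - orderStat x (n - k)| ≤ K * ζ * (A * U) ∧
      |sigmaMoment k x' - sigmaMoment k x| ≤ K * ζ * (A * U) ∧
      |sigmaMoment k x| ≤ K * (A * U) := by
  obtain ⟨K, hK, η, hη, H⟩ := exists_moment_ratio_bounds hc hB
  refine ⟨(4 * D + 2 * K) + C + (3 * C * D * (B + 4) * K + 12 * C * K + 2 * C * B * K) +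
    C * B * K, by positivity, min (min 1 (η / 4)) (1 / (2 * D)), by positivity, ?_⟩
  intro n k x x' A U ζ hk0 hk hx hU hA hAD hxU hM1 hV hζ hζη herr
  have hζ1 : ζ ≤ 1 := hζη.trans ((min_le_left _ _).trans (min_le_left _ _))
  have hζ2 : 4 * ζ ≤ η := by
    have := hζη.trans ((min_le_left _ _).trans (min_le_right _ _))
    linarith
  have hζ3 : ζ * A ≤ 1 / 2 := by
    have h1 := hζη.trans (min_le_right _ _)
    rw [le_div_iff₀ (by positivity)] at h1
    linarith [mul_le_mul_of_nonneg_left hAD hζ]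
  have hrel : ∀ j ≤ k, |orderStat x' (n - j) / orderStat x (n - j) - 1| ≤ ζ * A := fun j hj =>
    (Finset.le_sup' (fun j => |orderStat x' (n - j) / orderStat x (n - j) - 1|)
      (Finset.mem_range.2 (by omega))).trans herr
  have hX0 : 0 < orderStat x (n - k) := by
    obtain ⟨l, hl⟩ := exists_orderStat_eq x (i := n - k) (by omega) (by omega)
    rw [hl]; exact hx l
  have hm0 := logMoment_one_nonneg hk hx
  obtain ⟨d1, d2⟩ := abs_logMoment_sub_le hk0 hk hx hζ3 hrel
  obtain ⟨p, p', r1, r2⟩ := H A _ _ _ _ (4 * (ζ * A)) hA hm0 hM1 hV (by positivity)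
    (by linarith [mul_le_mul_of_nonneg_right hζ2 hA.le]) d1 d2
  rw [show 4 * (ζ * A) / A = 4 * ζ by field_simp] at r2
  have g := one_sub_gammaMinus p
  have g' := one_sub_gammaMinus p'
  set ρ := logMoment k 2 x / (logMoment k 2 x - logMoment k 1 x ^ 2)
  set ρ' := logMoment k 2 x' / (logMoment k 2 x' - logMoment k 1 x' ^ 2)
  set X := orderStat x (n - k)
  set X' := orderStat x' (n - k)
  set m := logMoment k 1 x with hm
  set m' := logMoment k 1 x' with hm'
  have hXd : |X' - X| ≤ C * ζ * (A * U) := by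
    have h1 := hrel k le_rfl
    rw [div_sub_one hX0.ne', abs_div, abs_of_pos hX0, div_le_iff₀ hX0] at h1
    calc _ ≤ ζ * A * X := h1
      _ ≤ ζ * A * (C * U) := by gcongr
      _ = _ := by ring
  have hm'abs : |m'| ≤ (B + 4) * A := by
    have h1 := abs_le.1 d1
    have h2 : ζ * A ≤ A := mul_le_of_le_one_left hA.le hζ1
    have h3 : 0 < B * A := by positivity
    rw [abs_le]
    constructor <;> linarith
  have hρ' : |ρ'| ≤ 5 * K := by
    have h1 := abs_le.1 r1
    have h2 := abs_le.1 r2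
    have h3 : K * (4 * ζ) ≤ 4 * K := by linarith [mul_le_mul_of_nonneg_left hζ1 hK.le]
    rw [abs_le]; constructor <;> linarith
  have mono : ∀ {u v w : ℝ}, u ≤ v → 0 ≤ w → u * w ≤ v * w := fun h1 h2 =>
    mul_le_mul_of_nonneg_right h1 h2
  have hAU : 0 < A * U := by positivity
  refine ⟨?_, ?_, ?_, ?_⟩
  · have h1 : gammaMoment k x' - gammaMoment k x = (m' - m) - 1 / 2 * (ρ' - ρ) := by
      simp only [gammaMoment, gammaPlus]
      linarith
    have h2 : 4 * (ζ * A) ≤ 4 * D * ζ := by linarith [mul_le_mul_of_nonneg_left hAD hζ]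
    rw [h1]
    calc _ ≤ |m' - m| + |1 / 2 * (ρ' - ρ)| := abs_sub _ _
      _ ≤ 4 * D * ζ + 1 / 2 * (K * (4 * ζ)) := by
        rw [abs_mul, abs_of_pos (by norm_num : (0 : ℝ) < 1 / 2)]
        gcongr
        exact d1.trans h2
      _ = (4 * D + 2 * K) * ζ := by ring
      _ ≤ _ := by
        refine mono ?_ hζ
        simp only [add_assoc]
        gcongr
        exact le_add_of_nonneg_right (by positivity)
  · refine hXd.trans (mono (mono ?_ hζ) hAU.le)
    have : 0 < (4 * D + 2 * K) := by positivity
    have : 0 < (3 * C * D * (B + 4) * K + 12 * C * K + 2 * C * B * K) + C * B * K := by positivity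
    linarith
  · have h1 : sigmaMoment k x' - sigmaMoment k x = 1 / 2 * ((X' - X) * m' * ρ' +
        X * (m' - m) * ρ' + X * m * (ρ' - ρ)) := by
      simp only [sigmaMoment, g, g']
      ring
    have t1 : |(X' - X) * m' * ρ'| ≤ (C * ζ * (A * U)) * ((B + 4) * D) * (5 * K) := by
      rw [abs_mul, abs_mul]
      gcongr
      exact hm'abs.trans (by gcongr)
    have t2 : |X * (m' - m) * ρ'| ≤ (C * U) * (4 * (ζ * A)) * (5 * K) := by
      rw [abs_mul, abs_mul, abs_of_pos hX0]
      gcongr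
    have t3 : |X * m * (ρ' - ρ)| ≤ (C * U) * (B * A) * (K * (4 * ζ)) := by
      rw [abs_mul, abs_mul, abs_of_pos hX0, abs_of_nonneg hm0]
      gcongr
    rw [h1, abs_mul, abs_of_pos (by norm_num : (0 : ℝ) < 1 / 2)]
    calc _ ≤ 1 / 2 * ((C * ζ * (A * U)) * ((B + 4) * D) * (5 * K) +
          (C * U) * (4 * (ζ * A)) * (5 * K) + (C * U) * (B * A) * (K * (4 * ζ))) := by
          gcongr
          exact (abs_add_three _ _ _).trans (add_le_add_three t1 t2 t3)
      _ = (5 / 2 * (C * D * (B + 4) * K) + 10 * C * K + 2 * C * B * K) * ζ * (A * U) := by ring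
      _ ≤ _ := by
        refine mono (mono ?_ hζ) hAU.le
        have : 0 < C * D * (B + 4) * K := by positivity
        have : 0 < C * K := by positivity
        have : 0 < C * B * K := by positivity
        linarith
  · simp only [sigmaMoment, g]
    rw [abs_mul, abs_mul, abs_mul, abs_of_pos hX0, abs_of_nonneg hm0,
      abs_of_pos (by norm_num : (0 : ℝ) < 1 / 2)]
    calc _ ≤ (C * U) * (B * A) * (1 / 2 * K) := by gcongr
      _ = (1 / 2 * (C * B * K)) * (A * U) := by ring
      _ ≤ _ := by
        refine mono ?_ hAU.le
        have : 0 < (4 * D + 2 * K) + C +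
          (3 * C * D * (B + 4) * K + 12 * C * K + 2 * C * B * K) := by positivity
        have : 0 < C * B * K := by positivity
        linarith

end Perturbation

/-! ### The extrapolation factor and `q_γ` -/

section QuantileFactor

lemma powQuot_eq_integral (g : ℝ) {d : ℝ} (hd : 1 ≤ d) :
    powQuot g d = ∫ s in (1 : ℝ)..d, s ^ (g - 1) := by
  have h0 : (0 : ℝ) ∉ Set.uIcc 1 d := by
    rw [Set.uIcc_of_le hd]; simp
  unfold powQuot
  split_ifs with hg
  · rw [hg, zero_sub]
    simp only [Real.rpow_neg_one]
    rw [integral_inv h0, div_one]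
  · rw [integral_rpow (Or.inr ⟨by simpa using hg, h0⟩)]
    simp

lemma intervalIntegrable_rpow_sub_one (g : ℝ) {b d : ℝ} (hb : 0 < b) (hd : b ≤ d) :
    IntervalIntegrable (fun s : ℝ => s ^ (g - 1)) volume b d :=
  intervalIntegral.intervalIntegrable_rpow (Or.inr (by
    rw [Set.uIcc_of_le hd]; simp [hb]))

lemma intervalIntegrable_rpow_mul_log (g : ℝ) {b d : ℝ} (hb : 0 < b) (hd : b ≤ d) :
    IntervalIntegrable (fun s : ℝ => s ^ (g - 1) * Real.log s) volume b d := by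
  refine ContinuousOn.intervalIntegrable fun s hs => ?_
  rw [Set.uIcc_of_le hd] at hs
  have hs0 : s ≠ 0 := (hb.trans_le hs.1).ne'
  exact ((Real.continuousAt_rpow_const s (g - 1) (Or.inl hs0)).mul
    (Real.continuousAt_log hs0)).continuousWithinAt

lemma rpow_sub_one_le {g γ b d s : ℝ} (hs : 1 ≤ s) (hsd : s ≤ d)
    (h : |g - γ| * Real.log d ≤ b) : s ^ (g - 1) ≤ Real.exp b * s ^ (γ - 1) := by
  have hs0 : 0 < s := by linarith
  rw [show g - 1 = (g - γ) + (γ - 1) by ring, Real.rpow_add hs0]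
  gcongr
  rw [Real.rpow_def_of_pos hs0]
  gcongr
  have h1 := Real.log_nonneg hs
  have h2 := Real.log_le_log hs0 hsd
  calc _ ≤ Real.log s * |g - γ| := by gcongr; exact le_abs_self _
    _ ≤ Real.log d * |g - γ| := by gcongr
    _ ≤ b := by linarith

lemma abs_rpow_sub_rpow_le {g g' γ b d s : ℝ} (hs : 1 ≤ s) (hsd : s ≤ d)
    (h : |g - γ| * Real.log d ≤ b) (h' : |g' - γ| * Real.log d ≤ b) :
    |s ^ (g' - 1) - s ^ (g - 1)| ≤ |g' - g| * Real.exp b * (s ^ (γ - 1) * Real.log s) := by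
  wlog hle : g ≤ g' generalizing g g'
  · rw [abs_sub_comm, abs_sub_comm g']
    exact this h' h (le_of_not_ge hle)
  have hs0 : 0 < s := by linarith
  have hlog := Real.log_nonneg hs
  have h1 : s ^ (g - 1) ≤ s ^ (g' - 1) := Real.rpow_le_rpow_of_exponent_le hs (by linarith)
  rw [abs_of_nonneg (sub_nonneg.2 h1), abs_of_nonneg (sub_nonneg.2 hle)]
  have h2 : s ^ (g - 1) = s ^ (g' - 1) * Real.exp (-(Real.log s * (g' - g))) := by
    rw [show g - 1 = (g' - 1) + (-(g' - g)) by ring, Real.rpow_add hs0,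
      Real.rpow_def_of_pos hs0 (-(g' - g)), mul_neg]
  have h3 := Real.add_one_le_exp (-(Real.log s * (g' - g)))
  have h4 := rpow_sub_one_le hs hsd h'
  calc s ^ (g' - 1) - s ^ (g - 1) = s ^ (g' - 1) * (1 - Real.exp (-(Real.log s * (g' - g)))) := by
        rw [h2]; ring
    _ ≤ s ^ (g' - 1) * (Real.log s * (g' - g)) := by gcongr; linarith
    _ ≤ (Real.exp b * s ^ (γ - 1)) * (Real.log s * (g' - g)) := by
        have : 0 ≤ g' - g := sub_nonneg.2 hle
        gcongr
    _ = _ := by ring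

lemma abs_powQuot_sub_le {g g' γ b d : ℝ} (hd : 1 ≤ d)
    (h : |g - γ| * Real.log d ≤ b) (h' : |g' - γ| * Real.log d ≤ b) :
    |powQuot g' d - powQuot g d| ≤ |g' - g| * Real.exp b * qFun γ d := by
  rw [powQuot_eq_integral g hd, powQuot_eq_integral g' hd,
    ← intervalIntegral.integral_sub (intervalIntegrable_rpow_sub_one g' one_pos hd)
      (intervalIntegrable_rpow_sub_one g one_pos hd), qFun,
    ← intervalIntegral.integral_const_mul, ← Real.norm_eq_abs]
  refine intervalIntegral.norm_integral_le_of_norm_le hd ?_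
    ((intervalIntegrable_rpow_mul_log γ one_pos hd).const_mul _)
  exact Eventually.of_forall fun s hs => abs_rpow_sub_rpow_le hs.1.le hs.2 h h'

lemma abs_powQuot_le {g γ b d : ℝ} (hd : 1 ≤ d) (h : |g - γ| * Real.log d ≤ b) :
    |powQuot g d| ≤ Real.exp b * powQuot γ d := by
  rw [powQuot_eq_integral g hd, powQuot_eq_integral γ hd, ← intervalIntegral.integral_const_mul,
    ← Real.norm_eq_abs]
  refine intervalIntegral.norm_integral_le_of_norm_le hd ?_
    ((intervalIntegrable_rpow_sub_one γ one_pos hd).const_mul _)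
  refine Eventually.of_forall fun s hs => ?_
  rw [Real.norm_of_nonneg (Real.rpow_nonneg (by linarith [hs.1]) _)]
  exact rpow_sub_one_le hs.1.le hs.2 h

/-- Both `1` and `(d^γ - 1)/γ` are `O(q_γ(d))`, since `log s ≥ 1` beyond `s = e`. -/
lemma exists_powQuot_le_qFun (γ : ℝ) :
    ∃ K > 0, ∀ d, Real.exp 1 ≤ d → 1 ≤ K * qFun γ d ∧ powQuot γ d ≤ K * qFun γ d := by
  have he : (1 : ℝ) < Real.exp 1 := Real.one_lt_exp_iff.2 one_pos
  have hpos : 0 < qFun γ (Real.exp 1) := by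
    refine intervalIntegral.intervalIntegral_pos_of_pos_on
      (intervalIntegrable_rpow_mul_log γ one_pos he.le) (fun s hs => ?_) he
    exact mul_pos (Real.rpow_pos_of_pos (by linarith [hs.1]) _) (Real.log_pos hs.1)
  have hq0 : 0 ≤ powQuot γ (Real.exp 1) := by
    rw [powQuot_eq_integral γ he.le]
    exact intervalIntegral.integral_nonneg he.le fun s hs =>
      Real.rpow_nonneg (by linarith [hs.1]) _
  refine ⟨1 / qFun γ (Real.exp 1) + powQuot γ (Real.exp 1) / qFun γ (Real.exp 1) + 1,
    by positivity, fun d hd => ?_⟩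
  have hsplit : qFun γ d = qFun γ (Real.exp 1) +
      ∫ s in (Real.exp 1)..d, s ^ (γ - 1) * Real.log s := by
    unfold qFun
    exact (intervalIntegral.integral_add_adjacent_intervals
      (intervalIntegrable_rpow_mul_log γ one_pos he.le)
      (intervalIntegrable_rpow_mul_log γ (Real.exp_pos 1) hd)).symm
  have hsplit' : powQuot γ d = powQuot γ (Real.exp 1) + ∫ s in (Real.exp 1)..d, s ^ (γ - 1) := by
    rw [powQuot_eq_integral γ (he.le.trans hd), powQuot_eq_integral γ he.le]
    exact (intervalIntegral.integral_add_adjacent_intervals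
      (intervalIntegrable_rpow_sub_one γ one_pos he.le)
      (intervalIntegrable_rpow_sub_one γ (Real.exp_pos 1) hd)).symm
  have hcomp : ∫ s in (Real.exp 1)..d, s ^ (γ - 1) ≤
      ∫ s in (Real.exp 1)..d, s ^ (γ - 1) * Real.log s := by
    refine intervalIntegral.integral_mono_on hd
      (intervalIntegrable_rpow_sub_one γ (Real.exp_pos 1) hd)
      (intervalIntegrable_rpow_mul_log γ (Real.exp_pos 1) hd) fun s hs => ?_
    have hs0 : 0 < s := (Real.exp_pos 1).trans_le hs.1
    have : 1 ≤ Real.log s := (Real.le_log_iff_exp_le hs0).2 hs.1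
    exact le_mul_of_one_le_right (Real.rpow_nonneg hs0.le _) this
  have htail0 : 0 ≤ ∫ s in (Real.exp 1)..d, s ^ (γ - 1) :=
    intervalIntegral.integral_nonneg hd fun s hs =>
      Real.rpow_nonneg ((Real.exp_pos 1).le.trans hs.1) _
  have hq : qFun γ (Real.exp 1) ≤ qFun γ d := by linarith
  have hqd : 0 < qFun γ d := hpos.trans_le hq
  have h1 : 1 ≤ 1 / qFun γ (Real.exp 1) * qFun γ d := by
    rw [div_mul_eq_mul_div, one_mul, le_div_iff₀ hpos]; linarith
  have h2 : powQuot γ (Real.exp 1) ≤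
      powQuot γ (Real.exp 1) / qFun γ (Real.exp 1) * qFun γ d := by
    rw [div_mul_eq_mul_div, le_div_iff₀ hpos]; gcongr
  constructor
  · nlinarith
  · nlinarith

end QuantileFactor

/-! ### Samples with the same upper order statistics -/

section Agreement

variable {n k : ℕ} {x x' : Fin n → ℝ}

lemma orderStat_eq_of_maxRelError_eq_zero (h : maxRelError k x' x = 0) :
    ∀ j ≤ k, orderStat x' (n - j) = orderStat x (n - j) := fun j hj => by
  have h1 : |orderStat x' (n - j) / orderStat x (n - j) - 1| ≤ 0 :=
    (Finset.le_sup' (fun j => |orderStat x' (n - j) / orderStat x (n - j) - 1|)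
      (Finset.mem_range.2 (by omega : j < k + 1))).trans h.le
  exact eq_of_div_eq_one (sub_eq_zero.1 (abs_nonpos_iff.1 h1))

lemma logMoment_congr (h : ∀ j ≤ k, orderStat x' (n - j) = orderStat x (n - j)) (ℓ : ℕ) :
    logMoment k ℓ x' = logMoment k ℓ x := by
  unfold logMoment
  congr 1
  refine Finset.sum_congr rfl fun j hj => ?_
  rw [h j (Finset.mem_range.1 hj).le, h k le_rfl]

lemma gammaMoment_congr (h : ∀ j ≤ k, orderStat x' (n - j) = orderStat x (n - j)) :
    gammaMoment k x' = gammaMoment k x := by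
  simp only [gammaMoment, gammaPlus, gammaMinus, logMoment_congr h]

lemma sigmaMoment_congr (h : ∀ j ≤ k, orderStat x' (n - j) = orderStat x (n - j)) :
    sigmaMoment k x' = sigmaMoment k x := by
  simp only [sigmaMoment, gammaMinus, logMoment_congr h, h k le_rfl]

lemma extremeQuantile_congr (h : ∀ j ≤ k, orderStat x' (n - j) = orderStat x (n - j)) (p : ℝ) :
    extremeQuantile k p x' = extremeQuantile k p x := by
  simp only [extremeQuantile, sigmaMoment_congr h, gammaMoment_congr h, h k le_rfl]

end Agreement

/-! ### The growth of `d_n = k/(np)` -/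

section ExtrapolationFactor

variable {k : ℕ → ℕ} {p : ℕ → ℝ}

lemma tendsto_div_mul_atTop (hp : ∀ n, 0 < p n) (hk : Tendsto k atTop atTop)
    (h : (fun n : ℕ => (n : ℝ) * p n) =o[atTop] (fun n => (k n : ℝ))) :
    Tendsto (fun n : ℕ => (k n : ℝ) / (n * p n)) atTop atTop := by
  have h1 : Tendsto (fun n : ℕ => (n : ℝ) * p n / k n) atTop (𝓝[>] 0) := by
    refine tendsto_nhdsWithin_iff.2 ⟨h.tendsto_div_nhds_zero, ?_⟩
    filter_upwards [hk.eventually_gt_atTop 0, eventually_gt_atTop 0] with n h2 h3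
    have h2' : (0 : ℝ) < k n := by exact_mod_cast h2
    have h3' : (0 : ℝ) < n := by exact_mod_cast h3
    exact div_pos (mul_pos h3' (hp n)) h2'
  refine h1.inv_tendsto_nhdsGT_zero.congr fun n => ?_
  simp

lemma eventually_log_div_mul_le_sqrt (hp : ∀ n, 0 < p n) (hk : Tendsto k atTop atTop)
    (h : (fun n : ℕ => Real.log ((n : ℝ) * p n)) =o[atTop] (fun n => √(k n : ℝ))) :
    ∀ᶠ n : ℕ in atTop, Real.log ((k n : ℝ) / (n * p n)) ≤ √(k n : ℝ) := by
  have hlog := (isLittleO_log_rpow_atTop (half_pos one_pos)).comp_tendsto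
    (tendsto_natCast_atTop_atTop.comp hk)
  filter_upwards [h.bound (half_pos one_pos), hlog.bound (half_pos one_pos),
    hk.eventually_gt_atTop 0, eventually_gt_atTop 0] with n h1 h2 h3 h4
  have h3' : (0 : ℝ) < k n := by exact_mod_cast h3
  have h4' : (0 : ℝ) < n := by exact_mod_cast h4
  simp only [Function.comp_apply, ← Real.sqrt_eq_rpow, Real.norm_eq_abs,
    abs_of_nonneg (Real.sqrt_nonneg _)] at h1 h2
  rw [Real.log_div h3'.ne' (mul_pos h4' (hp n)).ne']
  have h5 := (abs_le.1 h1).1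
  have h6 := (abs_le.1 h2).2
  linarith

end ExtrapolationFactor

/-! ### The extreme quantile estimator -/

section QuantileEstimator

/-- Error of the extreme quantile estimator for a sample satisfying the bounds of
`asympCertain_estimator_errors`, when both estimates of the index are within `b / log d` of the
true one. -/
lemma exists_extremeQuantile_error_le (γ K b : ℝ) (hK : 0 ≤ K) :
    ∃ C, ∀ (n k : ℕ) (x x' : Fin n → ℝ) (p α ζ : ℝ), 0 < α → 0 ≤ ζ →
      Real.exp 1 ≤ (k : ℝ) / (n * p) →
      |gammaMoment k x - γ| * Real.log ((k : ℝ) / (n * p)) ≤ b →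
      |gammaMoment k x' - γ| * Real.log ((k : ℝ) / (n * p)) ≤ b →
      |gammaMoment k x' - gammaMoment k x| ≤ K * ζ →
      |orderStat x' (n - k) - orderStat x (n - k)| ≤ K * ζ * α →
      |sigmaMoment k x' - sigmaMoment k x| ≤ K * ζ * α →
      |sigmaMoment k x| ≤ K * α →
      |(extremeQuantile k p x' - extremeQuantile k p x) /
        (α * qFun γ ((k : ℝ) / (n * p)))| ≤ C * ζ := by
  obtain ⟨L, hL, H⟩ := exists_powQuot_le_qFun γ
  refine ⟨K * (L + Real.exp b * L + K * Real.exp b), ?_⟩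
  intro n k x x' p α ζ hα hζ hd hg hg' h1 h2 h3 h4
  set d := (k : ℝ) / (n * p) with hdef
  have hd1 : 1 ≤ d := (Real.one_le_exp one_pos.le).trans hd
  obtain ⟨q1, q2⟩ := H d hd
  have hq : 0 < qFun γ d := by
    by_contra! hneg
    have := mul_nonpos_of_nonneg_of_nonpos hL.le hneg
    linarith
  have f1 := abs_powQuot_sub_le hd1 hg hg'
  have f2 := abs_powQuot_le hd1 hg'
  set g := gammaMoment k x
  set g' := gammaMoment k x'
  have hdec : extremeQuantile k p x' - extremeQuantile k p x =
      (orderStat x' (n - k) - orderStat x (n - k)) +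
      (sigmaMoment k x' - sigmaMoment k x) * powQuot g' d +
      sigmaMoment k x * (powQuot g' d - powQuot g d) := by
    simp only [extremeQuantile]
    ring
  have hden : 0 < α * qFun γ d := by positivity
  rw [abs_div, abs_of_pos hden, div_le_iff₀ hden, hdec]
  have t1 : |orderStat x' (n - k) - orderStat x (n - k)| ≤ K * ζ * α * (L * qFun γ d) :=
    h2.trans (le_mul_of_one_le_right (by positivity) q1)
  have t2 : |(sigmaMoment k x' - sigmaMoment k x) * powQuot g' d| ≤
      K * ζ * α * (Real.exp b * (L * qFun γ d)) := by
    rw [abs_mul]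
    gcongr
    exact f2.trans (by gcongr)
  have t3 : |sigmaMoment k x * (powQuot g' d - powQuot g d)| ≤
      K * α * (K * ζ * Real.exp b * qFun γ d) := by
    rw [abs_mul]
    gcongr
    exact f1.trans (by gcongr)
  calc _ ≤ _ := (abs_add_three _ _ _).trans (add_le_add_three t1 t2 t3)
    _ = _ := by ring

end QuantileEstimator

/-! ### Errors in probability -/

section Estimators

variable {Ω : Type*} [MeasurableSpace Ω] {P : Measure Ω}
  {ν : Measure ℝ} [IsProbabilityMeasure ν] {X X' : (n : ℕ) → Fin n → Ω → ℝ} {k : ℕ → ℕ}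
  {a : ℝ → ℝ} {γ : ℝ} {h z : ℕ → ℝ}

/-- For large `n`, `z n = 0` forces `h n = 0`, as `U(n/k)` and `a(n/k)` are then positive; so the
two samples have the same upper order statistics.  A ratio equal to `1` has a nonzero denominator,
which is why positivity of the sample plays no role. -/
lemma eventually_ae_orderStat_eq (h0 : ν (Set.Iic 0) = 0)
    (hERV : IsERV (tailQuantile ν) γ a)
    (hk : Tendsto k atTop atTop) (hkn : Tendsto (fun n => (k n : ℝ) / (n : ℝ)) atTop (𝓝 0))
    (herr : IsBigOP P
      (fun n ω => maxRelError (k n) (fun l => X' n l ω) (fun l => X n l ω)) (fun n _ => h n))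
    (hz : ∀ n, z n =
      h n * tailQuantile ν ((n : ℝ) / (k n : ℝ)) / a ((n : ℝ) / (k n : ℝ))) :
    ∀ᶠ n in atTop, z n = 0 → ∀ᵐ ω ∂P, ∀ j ≤ k n,
      orderStat (fun l => X' n l ω) (n - j) = orderStat (fun l => X n l ω) (n - j) := by
  obtain ⟨Z, -, -, hZ⟩ := herr
  have hT := tendsto_div_atTop hk hkn
  filter_upwards [hZ, hT.eventually hERV.1, hT.eventually_gt_atTop 1] with n h1 h2 h3 h4
  have hU := tailQuantile_pos ν h0 h3
  have h5 : h n = 0 := by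
    rw [hz n, div_eq_zero_iff, mul_eq_zero] at h4
    exact (h4.resolve_right h2.ne').resolve_right hU.ne'
  filter_upwards [h1] with ω hω
  rw [h5, zero_mul] at hω
  exact orderStat_eq_of_maxRelError_eq_zero hω

variable [IsProbabilityMeasure P]

/-- The joint form, in probability, of the bounds on the errors of the index, the threshold and the
scale. -/
theorem asympCertain_estimator_errors (hX : ∀ n l, AEMeasurable (X n l) P)
    (hind : ∀ n, iIndepFun (X n) P) (hν : ∀ n l, P.map (X n l) = ν) (h0 : ν (Set.Iic 0) = 0)
    (hERV : IsERV (tailQuantile ν) γ a)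
    (hk : Tendsto k atTop atTop) (hkn : Tendsto (fun n => (k n : ℝ) / (n : ℝ)) atTop (𝓝 0))
    (herr : IsBigOP P
      (fun n ω => maxRelError (k n) (fun l => X' n l ω) (fun l => X n l ω)) (fun n _ => h n))
    (hz : ∀ n, z n =
      h n * tailQuantile ν ((n : ℝ) / (k n : ℝ)) / a ((n : ℝ) / (k n : ℝ)))
    (hz0 : Tendsto z atTop (𝓝 0)) :
    AsympCertain P fun (K : ℝ) n ω =>
      |gammaMoment (k n) (fun l => X' n l ω) - gammaMoment (k n) (fun l => X n l ω)| ≤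
        K * |z n| ∧
      |orderStat (fun l => X' n l ω) (n - k n) - orderStat (fun l => X n l ω) (n - k n)| ≤
        K * |z n| * a ((n : ℝ) / (k n : ℝ)) ∧
      |sigmaMoment (k n) (fun l => X' n l ω) - sigmaMoment (k n) (fun l => X n l ω)| ≤
        K * |z n| * a ((n : ℝ) / (k n : ℝ)) ∧
      |sigmaMoment (k n) (fun l => X n l ω)| ≤ K * a ((n : ℝ) / (k n : ℝ)) := by
  have hpos : ∀ t, 1 < t → 0 < tailQuantile ν t := fun t ht => tailQuantile_pos ν h0 ht
  obtain ⟨D, hD, HD⟩ := hERV.scale_le hpos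
  obtain ⟨c, hc, C, hC, E⟩ :=
    exists_asympCertain_logMoment_bounds hX hind hν h0 hERV hk hkn
  have hT := tendsto_div_atTop hk hkn
  have hX0 : ∀ n, ∀ᵐ ω ∂P, ∀ l, 0 < X n l ω := fun n => by
    refine ae_all_iff.2 fun l => ?_
    have : ∀ᵐ y ∂(P.map (X n l)), 0 < y := by
      rw [hν, ae_iff]
      simpa [Set.Iic] using h0
    exact ae_of_ae_map (hX n l) this
  refine (E.and herr.asympCertain).mono fun b => ?_
  obtain ⟨B₁, B₂⟩ := b
  obtain ⟨K, hK, η, hη, H⟩ := exists_perturbation_bounds (B := |B₁| + 1) (C := C) (D := D) hc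
    (by positivity) hC hD
  refine ⟨K * (|B₂| + 1), ?_⟩
  have hζ : Tendsto (fun n => (|B₂| + 1) * |z n|) atTop (𝓝 0) := by
    simpa using hz0.abs.const_mul (|B₂| + 1)
  filter_upwards [hT.eventually HD, hT.eventually hERV.1, hT.eventually_gt_atTop 1,
    hk.eventually_gt_atTop 0, eventually_lt_of_div_tendsto_zero hkn,
    hζ.eventually (gt_mem_nhds hη)] with n h1 h2 h3 h4 h5 h6
  filter_upwards [hX0 n] with ω hω
  rintro ⟨⟨e1, e2, e3⟩, e4⟩
  have hU := hpos _ h3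
  set U := tailQuantile ν ((n : ℝ) / k n) with hUdef
  set α := a ((n : ℝ) / k n) with hα
  have hA : 0 < α / U := div_pos h2 hU
  have hAU : α / U * U = α := by field_simp
  have hzA : |z n| * (α / U) = |h n| := by
    rw [hz n, ← hUdef, ← hα, abs_div, abs_mul, abs_of_pos hU, abs_of_pos h2]
    field_simp
  obtain ⟨r1, r2, r3, r4⟩ := H n (k n) (fun l => X n l ω) (fun l => X' n l ω) (α / U) U
    ((|B₂| + 1) * |z n|) h4 h5 hω hU hA (by rw [div_le_iff₀ hU]; exact h1) e1
    (e2.trans (by gcongr; exact (le_abs_self B₁).trans (by linarith))) e3 (by positivity) h6.le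
    (by
      rw [mul_assoc, hzA]
      refine (le_abs_self _).trans (e4.trans ?_)
      gcongr
      exact (le_abs_self B₂).trans (by linarith))
  rw [hAU] at r2 r3 r4
  simp only [mul_assoc] at r1 r2 r3 r4 ⊢
  refine ⟨r1, r2, r3, r4.trans ?_⟩
  gcongr
  exact le_mul_of_one_le_left h2.le (by linarith [abs_nonneg B₂])

end Estimators

end EVT

theorem theorem1 {Ω : Type*} [MeasurableSpace Ω] (P : Measure Ω) [IsProbabilityMeasure P]
    -- the almost surely positive random variable, in the domain of attraction of `G_γ`
    (Y₀ : Ω → ℝ) (hY₀ : AEMeasurable Y₀ P) (hpos : ∀ᵐ ω ∂P, 0 < Y₀ ω)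
    (γ : ℝ) (hDom : InMaxDomainOfAttraction (P.map Y₀) (gevCDF γ))
    -- the scaling function `a` of `U`
    (a : ℝ → ℝ) (ha : IsERV (tailQuantile (P.map Y₀)) γ a)
    -- for each `n`, i.i.d. copies of `Y₀` and an approximated sample
    (Y Yhat : (n : ℕ) → Fin n → Ω → ℝ)
    (hindep : ∀ n, iIndepFun (Y n) P)
    (hident : ∀ n i, IdentDistrib (Y n i) Y₀ P P)
    (hYhat : ∀ n i, AEMeasurable (Yhat n i) P)
    -- (A1)
    (k : ℕ → ℕ) (hk : Tendsto k atTop atTop)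
    (hkn : Tendsto (fun n => (k n : ℝ) / (n : ℝ)) atTop (𝓝 0))
    -- size of the approximation error
    (h z : ℕ → ℝ)
    (herr : IsBigOP P
      (fun n ω => maxRelError (k n) (fun i => Yhat n i ω) (fun i => Y n i ω))
      (fun n _ => h n))
    (hz : ∀ n, z n =
      h n * tailQuantile (P.map Y₀) ((n : ℝ) / (k n : ℝ)) / a ((n : ℝ) / (k n : ℝ)))
    (hz0 : Tendsto z atTop (𝓝 0)) :
    IsBigOP P
      (fun n ω => |gammaMoment (k n) (fun i => Yhat n i ω)
        - gammaMoment (k n) (fun i => Y n i ω)|)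
      (fun n _ => z n) ∧
    IsBigOP P
      (fun n ω => |(orderStat (fun i => Yhat n i ω) (n - k n)
        - orderStat (fun i => Y n i ω) (n - k n)) / a ((n : ℝ) / (k n : ℝ))|)
      (fun n _ => z n) ∧
    IsBigOP P
      (fun n ω => |(sigmaMoment (k n) (fun i => Yhat n i ω)
        - sigmaMoment (k n) (fun i => Y n i ω)) / a ((n : ℝ) / (k n : ℝ))|)
      (fun n _ => z n) ∧
    ∀ p : ℕ → ℝ, (∀ n, 0 < p n) →
      -- (A2)
      (fun n : ℕ => (n : ℝ) * p n) =o[atTop] (fun n => (k n : ℝ)) →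
      (fun n : ℕ => Real.log ((n : ℝ) * p n)) =o[atTop] (fun n => √(k n : ℝ)) →
      -- (A3)
      IsBigOP P
        (fun n ω => √(k n : ℝ) * (gammaMoment (k n) (fun i => Y n i ω) - γ))
        (fun _ _ => 1) →
      (fun n => √(k n : ℝ) * z n) =O[atTop] (fun _ => (1 : ℝ)) →
      IsBigOP P
        (fun n ω => |(extremeQuantile (k n) (p n) (fun i => Yhat n i ω)
            - extremeQuantile (k n) (p n) (fun i => Y n i ω))
          / (a ((n : ℝ) / (k n : ℝ)) * qFun γ ((k n : ℝ) / ((n : ℝ) * p n)))|)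
        (fun n _ => z n) := by
  have hprob : IsProbabilityMeasure (P.map Y₀) := Measure.isProbabilityMeasure_map hY₀
  have h0 : P.map Y₀ (Set.Iic 0) = 0 := by
    rw [Measure.map_apply_of_aemeasurable hY₀ measurableSet_Iic]
    rw [ae_iff] at hpos
    simpa [Set.preimage, Set.Iic] using hpos
  have hYm : ∀ n l, AEMeasurable (Y n l) P := fun n l => (hident n l).aemeasurable_fst
  have hYm' : ∀ n, AEMeasurable (fun ω l => Y n l ω) P := fun n => aemeasurable_pi_lambda _ (hYm n)
  have hYhat' : ∀ n, AEMeasurable (fun ω l => Yhat n l ω) P := fun n =>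
    aemeasurable_pi_lambda _ (hYhat n)
  have core := asympCertain_estimator_errors hYm hindep (fun n l => (hident n l).map_eq) h0 ha hk
    hkn herr hz hz0
  have hzero := eventually_ae_orderStat_eq h0 ha hk hkn herr hz
  have hT := tendsto_div_atTop hk hkn
  refine ⟨?_, ?_, ?_, ?_⟩
  · refine AsympCertain.isBigOP (fun n => ?_) ?_ (core.mono fun K => ⟨K, ?_⟩)
    · exact (((measurable_gammaMoment (k n) n).comp_aemeasurable (hYhat' n)).sub
        ((measurable_gammaMoment (k n) n).comp_aemeasurable (hYm' n))).abs
    · filter_upwards [hzero] with n hn hzn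
      filter_upwards [hn hzn] with ω hω
      rw [gammaMoment_congr hω, sub_self, abs_zero]
    · refine Eventually.of_forall fun n => Eventually.of_forall fun ω hω => ?_
      rw [abs_abs]
      exact hω.1
  · refine AsympCertain.isBigOP (fun n => ?_) ?_ (core.mono fun K => ⟨K, ?_⟩)
    · exact ((((measurable_orderStat n _).comp_aemeasurable (hYhat' n)).sub
        ((measurable_orderStat n _).comp_aemeasurable (hYm' n))).div_const _).abs
    · filter_upwards [hzero] with n hn hzn
      filter_upwards [hn hzn] with ω hω
      rw [hω _ le_rfl, sub_self, zero_div, abs_zero]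
    · filter_upwards [hT.eventually ha.1] with n hn
      refine Eventually.of_forall fun ω hω => ?_
      rw [abs_abs, abs_div, abs_of_pos hn, div_le_iff₀ hn]
      exact hω.2.1
  · refine AsympCertain.isBigOP (fun n => ?_) ?_ (core.mono fun K => ⟨K, ?_⟩)
    · exact ((((measurable_sigmaMoment (k n) n).comp_aemeasurable (hYhat' n)).sub
        ((measurable_sigmaMoment (k n) n).comp_aemeasurable (hYm' n))).div_const _).abs
    · filter_upwards [hzero] with n hn hzn
      filter_upwards [hn hzn] with ω hω
      rw [sigmaMoment_congr hω, sub_self, zero_div, abs_zero]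
    · filter_upwards [hT.eventually ha.1] with n hn
      refine Eventually.of_forall fun ω hω => ?_
      rw [abs_abs, abs_div, abs_of_pos hn, div_le_iff₀ hn]
      exact hω.2.2.1
  · intro p hp hnp hlog hA3 hkz
    obtain ⟨W, hW⟩ := hkz.bound
    refine AsympCertain.isBigOP (fun n => ?_) ?_
      ((core.and (IsBigOP.asympCertain (w := fun _ => 1) hA3)).mono fun b => ?_)
    · exact ((((measurable_extremeQuantile (k n) (p n) n).comp_aemeasurable (hYhat' n)).sub
        ((measurable_extremeQuantile (k n) (p n) n).comp_aemeasurable (hYm' n))).div_const _).abs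
    · filter_upwards [hzero] with n hn hzn
      filter_upwards [hn hzn] with ω hω
      rw [extremeQuantile_congr hω, sub_self, zero_div, abs_zero]
    · obtain ⟨K, B⟩ := b
      -- Both index estimates are within `(|B| + |K| |W|) / √k` of `γ`, and `log d ≤ √k`.
      obtain ⟨C, hC⟩ := exists_extremeQuantile_error_le γ |K| (|B| + |K| * |W|) (abs_nonneg K)
      refine ⟨C, ?_⟩
      filter_upwards [hW, hT.eventually ha.1, eventually_log_div_mul_le_sqrt hp hk hlog,
        (tendsto_div_mul_atTop hp hk hnp).eventually_ge_atTop (Real.exp 1)] with n h1 h2 h3 h4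
      refine Eventually.of_forall fun ω => ?_
      rintro ⟨⟨e1, e2, e3, e4⟩, e5⟩
      have hKz : K * |z n| ≤ |K| * |z n| := by gcongr; exact le_abs_self K
      have hs := Real.sqrt_nonneg (k n : ℝ)
      rw [norm_one, mul_one, Real.norm_eq_abs, abs_mul, abs_of_nonneg hs] at h1
      rw [abs_mul, abs_of_nonneg hs, abs_one, mul_one] at e5
      have e6 := e1.trans hKz
      have hg : √(k n : ℝ) * |gammaMoment (k n) (fun l => Y n l ω) - γ| ≤ |B| + |K| * |W| :=
        e5.trans ((le_abs_self B).trans (le_add_of_nonneg_right (by positivity)))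
      have hg' : √(k n : ℝ) * |gammaMoment (k n) (fun l => Yhat n l ω) - γ| ≤
          |B| + |K| * |W| := by
        calc _ ≤ √(k n : ℝ) * (|K| * |z n| + |gammaMoment (k n) (fun l => Y n l ω) - γ|) := by
              gcongr
              exact (abs_sub_le _ (gammaMoment (k n) fun l => Y n l ω) _).trans
                (by gcongr)
          _ = |K| * (√(k n : ℝ) * |z n|) +
              √(k n : ℝ) * |gammaMoment (k n) (fun l => Y n l ω) - γ| := by ring
          _ ≤ |K| * |W| + |B| := by
              gcongr
              · exact h1.trans (le_abs_self W)
              · exact e5.trans (le_abs_self B)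
          _ = _ := add_comm _ _
      rw [abs_abs]
      refine hC n (k n) _ _ (p n) _ |z n| h2 (abs_nonneg _) h4 ?_ ?_ e6 (e2.trans (by gcongr))
        (e3.trans (by gcongr)) (e4.trans (by gcongr; exact le_abs_self K))
      · refine le_trans ?_ hg
        rw [mul_comm]
        gcongr
      · refine le_trans ?_ hg'
        rw [mul_comm]
        gcongr
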